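/- Let $\mathbb F$ be a field and let $N,S,\ell,K_c\ge 1$ be integers with $L=\ell K_c\le|\mathbb F|-S$. Put $R=K_c(N+\ell-1)-N+1$ and assume $R\le S$. Let $(f_{l,k})_{l\in[\ell],k\in[K_c]}$, $(\alpha_s)_{s\in[S]}$ be any $L+S$ distinct elements of $\mathbb F$ (such elements exist), and $\Delta_s^{l}=\prod_{k\in[K_c]}(f_{l,k}-\alpha_s)$. Let $V_1,\dots,V_N,W$ be finite-dimensional coordinate spaces over $\mathbb F$ and $\Omega:V_1\times\cdots\times V_N\to W$ an $N$-linear map. The $n$-th source holds $x^{(n)}_1,\dots,x^{(n)}_L\in V_n$; write $x^{(n)}_{l,k}=x^{(n)}_{K_c(l-1)+k}$. In the $N$-CSA code, server $s$ receives from source $n$ the share $\widetilde X^{(n),s}=(\widetilde X^{(n),s}_1,\dots,\widetilde X^{(n),s}_\ell)$ with $$\widetilde X^{(n),s}_l=\Delta_s^{l}\sum_{k\in[K_c]}\frac{1}{f_{l,k}-\alpha_s}\,x^{(n)}_{l,k},$$ and returns $Y_s=\sum_{l\in[\ell]}(\Delta_s^{l})^{-1}\,\Omega(\widetilde X^{(1),s}_l,\dots,\widetilde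 X^{(N),s}_l)$. There are decoding functions, one for each set of responsive servers, depending only on the points, on $N$ and on $\dim W$, such that the following holds; all implied constants and polylogarithmic exponents are absolute. Complexities count additions, subtractions, multiplications and divisions in $\mathbb F$ and are divided by $L$; $\widetilde{\mathcal O}(a\log^2 b)$ means at most $C\,a\,(1+\log b)^{2+c}$ for constants $C,c$. 1. Recovery: from the answers of any $R$ servers the user obtains all $L$ evaluations $\Omega(x^{(1)}_i,\dots,x^{(N)}_i)$, $i\in[L]$. This threshold is the smallest one that serves all $N$-linear maps: for every choice of the points there is an $\Omega$ for which the answers of arbitrary $r$ servers do not suffice for any $r<R$. 2. Upload cost (total number of uploaded field elements divided by $L\dim V_n$): $S/K_c$ for each $n$ with $\dim V_n>0$. Download cost (largest total number of field elements in the answers of $R$ servers, divided by $L\dim W$): $R/(\ell K_c)$ if $\dim W>0$. 3. Server complexity: if $\Omega$ can be computed with $\omega$ operations, then $\mathcal O(\omega/K_c)$ when $N\ge2$, and $\mathcal O((\omega+\dim W)/K_c)$ for every $N\ge 1$. 4. Encoding complexity for source $n$: $\widetilde{\mathcal O}\!\left(\frac{\dim(V_n)\,S\log^2S}{K_c}\right)$.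 Decoding complexity, for every set of $R$ servers: $\widetilde{\mathcal O}\!\left(\frac{\ell+N-1}{\ell}\dim(W)\log^2R\right)$. 5. Polynomials: let $\Phi:V_1\times\cdots\times V_M\to W$ be a polynomial map all of whose components have total degree at most $N$. Regard each monomial of degree $e$ as the $N$-linear product map $\mathbb F^N\to\mathbb F$ evaluated at its $e$ variables and at $N-e$ arguments equal to $1$, and let each server return the corresponding linear combination of the answers of the $N$-CSA codes of these maps. With the same shares and the same decoding functions, this recovers all $L$ evaluations of $\Phi$ from any $R$ servers, with the upload and download costs of 2. and the encoding and decoding complexities of 4. 6. LCC: for $\ell=1$ one has $R=K_cN-N+1$, and the codes are the Lagrange coded computing (LCC) codes up to nonzero constants: with $\beta_k=f_{1,k}$ and $u_k=\prod_{k'\ne k}(\beta_{k'}-\beta_k)^{-1}$, the LCC share of a batch $(x_k)$, i.e. the value at $\alpha_s$ of its Lagrange interpolation polynomial at the nodes $\beta_k$, is the $N$-CSA share of $(u_kx_k)$, and the LCC answer ($\Omega$, or $\Phi$, evaluated at the LCC shares) is $\Delta_s^{1}$ times the $N$-CSA answer computed from these shares (for $\Phi$, the constant $1$ is rescaled by $u_k$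 as well). In particular the LCC code recovers all evaluations from any $K_cN-N+1$ servers. -/

import Mathlib

open Finset

noncomputable section

/-! ### Arithmetic operation counts (straight-line computations over a field) -/

section Ops

variable {F : Type*} [Field F] {ι κ : Type*}

/-- What may be used after the first `t` steps of the computation `g`: the inputs, all constants of
the field, and the results of these steps, each of them seen as a function of the input. -/
def availableAfter (g : ℕ → (ι → F) → F) (t : ℕ) : Set ((ι → F) → F) :=
  {h | (∃ i, h = fun x => x i) ∨ (∃ a : F, h = fun _ => a) ∨ ∃ j < t, h = g j}

/-- `h` is the result of one field operation on two members of `A`; a divisor has to be nonzero on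
every input. -/
def IsArithStep (A : Set ((ι → F) → F)) (h : (ι → F) → F) : Prop :=
  ∃ a ∈ A, ∃ b ∈ A,
    h = a + b ∨ h = a - b ∨ h = a * b ∨ ((∀ x, b x ≠ 0) ∧ h = a / b)

/-- The function `Φ` can be computed with `t` arithmetic operations (additions, subtractions,
multiplications, divisions) in `F`. -/
def ComputableWithOps (t : ℕ) (Φ : (ι → F) → (κ → F)) : Prop :=
  ∃ g : ℕ → (ι → F) → F,
    (∀ j < t, IsArithStep (availableAfter g j) (g j)) ∧
    ∀ k, (fun x => Φ x k) ∈ availableAfter g t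

end Ops

/-- The logarithmic factor `1 + log b` of the complexity bounds (the summand `1` only matters for
`b = 1`). -/
def logFactor (b : ℕ) : ℝ := 1 + Real.log b

/-! ### Codes for distributed batch computation -/

/-- A family of decoding functions, one for each set of responsive servers, for answers that consist
of `w` field elements each and for `L` desired values in `F ^ w`. -/
abbrev DecoderFamily (F : Type*) (S L w : ℕ) : Type _ :=
  ∀ T : Finset (Fin S), (T → Fin w → F) → (Fin L → Fin w → F)

/-- A code `(f, h, d)` for `M` sources, `S` servers and batch size `L`. The `m`-th source holds `L`
vectors of `F ^ (v m)`; the user wants `L` vectors of `F ^ w`. The share of the `m`-th source for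
server `s` consists of field elements indexed by `ShareIdx m s`, and the answer of server `s` of
field elements indexed by `AnsIdx s`. -/
structure BatchCode (F : Type*) (S L M : ℕ) (v : Fin M → ℕ) (w : ℕ) where
  ShareIdx : Fin M → Fin S → Type
  shareFintype : ∀ m s, Fintype (ShareIdx m s)
  AnsIdx : Fin S → Type
  ansFintype : ∀ s, Fintype (AnsIdx s)
  enc : ∀ m s, (Fin L → Fin (v m) → F) → (ShareIdx m s → F)
  ans : ∀ s, (∀ m, ShareIdx m s → F) → (AnsIdx s → F)
  dec : ∀ T : Finset (Fin S), (∀ s : T, AnsIdx s → F) → (Fin L → Fin w → F)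

namespace BatchCode

variable {F : Type*} {S L M : ℕ} {v : Fin M → ℕ} {w : ℕ}

/-- The number of field elements in the share of source `m` for server `s`. -/
def shareSize (c : BatchCode F S L M v w) (m : Fin M) (s : Fin S) : ℕ :=
  @Fintype.card (c.ShareIdx m s) (c.shareFintype m s)

/-- The number of field elements in the answer of server `s`. -/
def ansSize (c : BatchCode F S L M v w) (s : Fin S) : ℕ :=
  @Fintype.card (c.AnsIdx s) (c.ansFintype s)

/-- The answer of server `s` when the sources hold the data `x`. -/
def response (c : BatchCode F S L M v w) (x : ∀ m, Fin L → Fin (v m) → F) (s : Fin S) :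
    c.AnsIdx s → F :=
  c.ans s fun m => c.enc m s (x m)

/-- The code is `r`-recoverable for the batch evaluation of `G`: for every realization of the data,
the decoder obtains all `L` evaluations of `G` from the answers of any `r` servers. -/
def Recoverable (c : BatchCode F S L M v w) (G : (∀ m, Fin (v m) → F) → (Fin w → F)) (r : ℕ) :
    Prop :=
  ∀ T : Finset (Fin S), T.card = r → ∀ x : ∀ m, Fin L → Fin (v m) → F,
    c.dec T (fun s => c.response x s) = fun l => G fun m => x m l

/-- Normalized upload cost of source `m`. -/
def uploadCost (c : BatchCode F S L M v w) (m : Fin M) : ℚ≥0 :=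
  (∑ s, (c.shareSize m s : ℚ≥0)) / (L * v m)

/-- Normalized download cost from `r` responsive servers (largest value over all sets of `r`
servers). -/
def downloadCost (c : BatchCode F S L M v w) (r : ℕ) : ℚ≥0 :=
  ((univ : Finset (Fin S)).powersetCard r).sup fun T =>
    (∑ s ∈ T, (c.ansSize s : ℚ≥0)) / (L * w)

/-- The computation of all shares of source `m`, as a map between coordinate spaces. -/
def encFlat (c : BatchCode F S L M v w) (m : Fin M) :
    (Fin L × Fin (v m) → F) → ((Σ s, c.ShareIdx m s) → F) :=
  fun x q => c.enc m q.1 (fun l i => x (l, i)) q.2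

/-- The computation of server `s`, as a map between coordinate spaces. -/
def ansFlat (c : BatchCode F S L M v w) (s : Fin S) :
    ((Σ m, c.ShareIdx m s) → F) → (c.AnsIdx s → F) :=
  fun X => c.ans s fun m i => X ⟨m, i⟩

/-- The decoder for the responsive set `T`, as a map between coordinate spaces. -/
def decFlat (c : BatchCode F S L M v w) (T : Finset (Fin S)) :
    ((Σ s : T, c.AnsIdx s) → F) → (Fin L × Fin w → F) :=
  fun y q => c.dec T (fun s i => y ⟨s, i⟩) q.1 q.2

end BatchCode

/-! ### N-CSA codes -/

section NCSA

variable {F : Type*} [Field F] {S ℓ K : ℕ}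

/-- The points `f l k` and `α s` are `ℓ * K + S` distinct elements of `F`. -/
def DistinctPoints (f : Fin ℓ → Fin K → F) (α : Fin S → F) : Prop :=
  Function.Injective (Sum.elim (fun p : Fin ℓ × Fin K => f p.1 p.2) α)

/-- `R = K (N + ℓ - 1) - N + 1` (no truncation for positive `ℓ`, `K`, `N`). -/
def ncsaThreshold (N ℓ K : ℕ) : ℕ := K * (N + ℓ - 1) - N + 1

/-- `Δ_s^{l,K} = ∏_k (f_{l,k} - α_s)`. -/
def csaDelta (f : Fin ℓ → Fin K → F) (α : Fin S → F) (l : Fin ℓ) (s : Fin S) : F :=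
  ∏ k, (f l k - α s)

/-- The share `(X_1, …, X_ℓ)` for server `s` of a batch `x_1, …, x_{ℓK}` of vectors of `F ^ d`, where
`X_l = Δ_s^{l,K} ∑_k (f_{l,k} - α_s)⁻¹ x_{l,k}`. The equivalence `finProdFinEquiv` enumerates the
pairs `(l, k)` as `K l + k` (with indices from `0`). -/
def csaShare (f : Fin ℓ → Fin K → F) (α : Fin S → F) {d : ℕ} (s : Fin S)
    (x : Fin (ℓ * K) → Fin d → F) : Fin ℓ × Fin d → F :=
  fun q => csaDelta f α q.1 s * ∑ k, (f q.1 k - α s)⁻¹ * x (finProdFinEquiv (q.1, k)) q.2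

/-- The answer `∑_l (Δ_s^{l,K})⁻¹ Ω(X_l^{(1)}, …, X_l^{(N)})` of server `s`. -/
def csaAnswer (f : Fin ℓ → Fin K → F) (α : Fin S → F) {N w : ℕ} {v : Fin N → ℕ}
    (Ω : MultilinearMap F (fun n : Fin N => Fin (v n) → F) (Fin w → F)) (s : Fin S)
    (X : ∀ n, Fin ℓ × Fin (v n) → F) : Fin w → F :=
  ∑ l, (csaDelta f α l s)⁻¹ • Ω fun n i => X n (l, i)

/-- The N-CSA code for the batch evaluation of `Ω`, used with the decoders `dec`. -/
def nCSACode (f : Fin ℓ → Fin K → F) (α : Fin S → F) {N w : ℕ} {v : Fin N → ℕ}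
    (Ω : MultilinearMap F (fun n : Fin N => Fin (v n) → F) (Fin w → F))
    (dec : DecoderFamily F S (ℓ * K) w) : BatchCode F S (ℓ * K) N v w where
  ShareIdx m _ := Fin ℓ × Fin (v m)
  shareFintype _ _ := inferInstance
  AnsIdx _ := Fin w
  ansFintype _ := inferInstance
  enc _ s := csaShare f α s
  ans s := csaAnswer f α Ω s
  dec := dec

/-- The evaluation map of a `w`-tuple of polynomials in the coordinates of `M` vectors. -/
def polyMap {M w : ℕ} {v : Fin M → ℕ} (Φ : Fin w → MvPolynomial (Σ m : Fin M, Fin (v m)) F)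
    (x : ∀ m, Fin (v m) → F) : Fin w → F :=
  fun j => MvPolynomial.eval (fun p => x p.1 p.2) (Φ j)

/-- The answer of server `s` for polynomials of total degree at most `N`. A monomial of degree
`e ≤ N` with coefficient `a` is `a` times the `N`-linear product map `F ^ N → F`, evaluated at the
`e` variables of the monomial and at `N - e` arguments equal to `1`; the server adds up the N-CSA
answers for all these `N`-linear maps. Here `X` is the coded data and `U` the coded constant `1`. -/
def csaPolyAnswer (f : Fin ℓ → Fin K → F) (α : Fin S → F) (N : ℕ) {M w : ℕ} {v : Fin M → ℕ}
    (Φ : Fin w → MvPolynomial (Σ m : Fin M, Fin (v m)) F) (s : Fin S)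
    (U : Fin ℓ × Fin 1 → F) (X : ∀ m, Fin ℓ × Fin (v m) → F) : Fin w → F :=
  fun j => ∑ e ∈ (Φ j).support, (Φ j).coeff e *
    ∑ l, (csaDelta f α l s)⁻¹ *
      ((∏ p ∈ e.support, X p.1 (l, p.2) ^ e p) * U (l, 0) ^ (N - e.degree))

/-- The N-CSA code for the batch evaluation of polynomials of total degree at most `N`. -/
def nCSAPolyCode (f : Fin ℓ → Fin K → F) (α : Fin S → F) (N : ℕ) {M w : ℕ} {v : Fin M → ℕ}
    (Φ : Fin w → MvPolynomial (Σ m : Fin M, Fin (v m)) F)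
    (dec : DecoderFamily F S (ℓ * K) w) : BatchCode F S (ℓ * K) M v w where
  ShareIdx m _ := Fin ℓ × Fin (v m)
  shareFintype _ _ := inferInstance
  AnsIdx _ := Fin w
  ansFintype _ := inferInstance
  enc _ s := csaShare f α s
  ans s := csaPolyAnswer f α N Φ s (csaShare f α s fun _ _ => 1)
  dec := dec

end NCSA

/-! ### Lagrange coded computing -/

section LCC

variable {F : Type*} [Field F] {S L : ℕ}

/-- The value at `α_s` of the Lagrange interpolation polynomial of the data `x` at the nodes `β`. -/
def lccShare (β : Fin L → F) (α : Fin S → F) {d : ℕ} (s : Fin S)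
    (x : Fin L → Fin d → F) : Fin d → F :=
  fun i => ∑ l, x l i * ∏ l' ∈ univ.erase l, (α s - β l') / (β l - β l')

/-- The LCC code for the batch evaluation of `G`: each server evaluates `G` at its shares. -/
def lccCode (β : Fin L → F) (α : Fin S → F) {M w : ℕ} {v : Fin M → ℕ}
    (G : (∀ m, Fin (v m) → F) → (Fin w → F)) (dec : DecoderFamily F S L w) :
    BatchCode F S L M v w where
  ShareIdx m _ := Fin (v m)
  shareFintype _ _ := inferInstance
  AnsIdx _ := Fin w
  ansFintype _ := inferInstance
  enc _ s := lccShare β α s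
  ans _ := G
  dec := dec

/-- The nonzero constants `(∏_{j ≠ i} (β_j - β_i))⁻¹` by which the data has to be rescaled to turn the
Cauchy encoding of a single group into Lagrange encoding. -/
def lccWeight (β : Fin L → F) (i : Fin L) : F := (∏ j ∈ univ.erase i, (β j - β i))⁻¹

end LCC

end

/-! Decoding is interpolation. Within a group, the factor Δ_s^l cancels the poles of the Cauchy sum,
so a share is the value at α_s of a polynomial of degree at most K - 1 that equals a nonzero
constant times x_{l,k} at f_{l,k} (`csaShare_eq`, `eval_sharePoly_self`). Hence Ω of the shares is
H_l(α_s) with deg H_l ≤ N (K - 1), and H_l(f_{l,k}) is a nonzero multiple of the desired value.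
Multiplied by the Δ of all groups, the answer becomes P(α_s) with P = ∑ E_l H_l, where E_l has
degree at most K (ℓ - 1) and vanishes at the points of all other groups. So deg P < R, any R answers
determine P, and P(f_{l,k}) gives the desired value (`csaDecoder_eq`). Polynomial maps fit in after
homogenization with the coded constant 1; for ℓ = 1 the shares are Lagrange shares of rescaled data.

The threshold is optimal for the product of N scalars, because R - 1 = (L - 1) + (N - 1)(K - 1).
Fewer than R servers are covered by N - 1 blocks of at most K - 1 servers and at most L - 1 others.
One source per block holds nowhere vanishing data whose shares vanish on that block. On the others,
the answers are linear in the data of the last source: at most L - 1 equations in L unknowns. A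
nonzero solution gives the same answers as zero data, but a nonzero product (`not_recoverable`).

Encoding and decoding are products with diagonally scaled Cauchy matrices; whatever depends only on
the points is a free constant. The field may have hardly more than S elements and need not contain
suitable roots of unity. So a Hankel matrix of size n is reduced to sizes of order √n through powers
of a single element (`hankel_recursion`), at cost O(n log^5 n). Divide and conquer over the nodes
adds one logarithm (`SymOps.nodalMatrix`), and a Cauchy matrix factors through two nodal matrices
and a Hankel matrix (`cauchyOps`). -/

noncomputable section

set_option linter.unusedSectionVars false

/-! ### A calculus of operation counts -/

section Derives

variable {F : Type*} [Field F] {ι : Type*}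

/-- `t` arithmetic steps, starting from the functions in `A`, are enough to obtain all functions
in `B`. -/
def Derives (A : Set ((ι → F) → F)) (t : ℕ) (B : Set ((ι → F) → F)) : Prop :=
  ∃ g : ℕ → (ι → F) → F,
    (∀ j < t, IsArithStep (A ∪ {h | ∃ i < j, h = g i}) (g j)) ∧ B ⊆ A ∪ {h | ∃ i < t, h = g i}

variable {A A' B B' C : Set ((ι → F) → F)} {s t : ℕ}

theorem IsArithStep.mono {h : (ι → F) → F} (hA : A ⊆ A') (H : IsArithStep A h) :
    IsArithStep A' h := by
  obtain ⟨a, ha, b, hb, H⟩ := H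
  exact ⟨a, hA ha, b, hA hb, H⟩

theorem Derives.of_subset (h : B ⊆ A) : Derives A 0 B :=
  ⟨fun _ => 0, by simp, h.trans Set.subset_union_left⟩

theorem Derives.mono (hA : A ⊆ A') (hB : B' ⊆ B) (H : Derives A t B) : Derives A' t B' := by
  obtain ⟨g, h1, h2⟩ := H
  exact ⟨g, fun j hj => (h1 j hj).mono (Set.union_subset_union_left _ hA),
    hB.trans (h2.trans (Set.union_subset_union_left _ hA))⟩

theorem Derives.trans (H : Derives A s B) (H' : Derives (A ∪ B) t C) :
    Derives A (s + t) (B ∪ C) := by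
  obtain ⟨g, g1, g2⟩ := H
  obtain ⟨k, k1, k2⟩ := H'
  set m : ℕ → (ι → F) → F := fun j => if j < s then g j else k (j - s) with hm
  have e1 : ∀ i < s, g i = m i := fun i hi => by simp [hm, hi]
  have e2 : ∀ i, k i = m (s + i) := fun i => by simp [hm]
  have hB : ∀ r, B ⊆ A ∪ {h | ∃ i < s + r, h = m i} := fun r => g2.trans <| by
    refine Set.union_subset_union_right _ ?_
    rintro _ ⟨i, hi, rfl⟩
    exact ⟨i, by omega, e1 i hi⟩
  have hk : ∀ r, (A ∪ B) ∪ {h | ∃ i < r, h = k i} ⊆ A ∪ {h | ∃ i < s + r, h = m i} := fun r => by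
    refine Set.union_subset (Set.union_subset Set.subset_union_left (hB r)) ?_
    rintro _ ⟨i, hi, rfl⟩
    exact Or.inr ⟨s + i, by omega, e2 i⟩
  refine ⟨m, fun j hj => ?_, Set.union_subset (hB t) (k2.trans (hk t))⟩
  by_cases hjs : j < s
  · rw [← e1 j hjs]
    refine (g1 j hjs).mono (Set.union_subset_union_right _ ?_)
    rintro _ ⟨i, hi, rfl⟩
    exact ⟨i, hi, e1 i (hi.trans hjs)⟩
  · obtain ⟨r, rfl⟩ := Nat.exists_eq_add_of_le (not_lt.mp hjs)
    rw [← e2 r]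
    exact (k1 r (by omega)).mono (hk r)

theorem Derives.then (H : Derives A s B) (H' : Derives (A ∪ B) t C) : Derives A (s + t) C :=
  (H.trans H').mono subset_rfl Set.subset_union_right

theorem Derives.union (H : Derives A s B) (H' : Derives A t C) : Derives A (s + t) (B ∪ C) :=
  H.trans (H'.mono Set.subset_union_left subset_rfl)

theorem Derives.step {h : (ι → F) → F} (H : IsArithStep A h) : Derives A 1 {h} :=
  ⟨fun _ => h, fun _ _ => H.mono Set.subset_union_left, fun _ hx => Or.inr ⟨0, by simp, hx⟩⟩

theorem Derives.biUnion {γ : Type*} (s : Finset γ) (t : γ → ℕ) (B : γ → Set ((ι → F) → F))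
    (H : ∀ c ∈ s, Derives A (t c) (B c)) : Derives A (∑ c ∈ s, t c) (⋃ c ∈ s, B c) := by
  classical
  induction s using Finset.induction_on with
  | empty => exact Derives.of_subset (by simp)
  | insert a s ha ih =>
    rw [Finset.sum_insert ha, Finset.set_biUnion_insert]
    exact (H a (by simp)).union (ih fun c hc => H c (by simp [hc]))

theorem Derives.iUnion {γ : Type*} [Fintype γ] (t : γ → ℕ) (B : γ → Set ((ι → F) → F))
    (H : ∀ c, Derives A (t c) (B c)) : Derives A (∑ c, t c) (⋃ c, B c) := by
  simpa using Derives.biUnion univ t B fun c _ => H c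

theorem Derives.range {γ : Type*} [Fintype γ] (f : γ → (ι → F) → F)
    (H : ∀ c, Derives A t {f c}) : Derives A (Fintype.card γ * t) (Set.range f) := by
  have := Derives.iUnion (fun _ : γ => t) (fun c => {f c}) H
  simpa using this

theorem IsArithStep.add {a b : (ι → F) → F} (ha : a ∈ A) (hb : b ∈ A) : IsArithStep A (a + b) :=
  ⟨a, ha, b, hb, Or.inl rfl⟩

theorem IsArithStep.mul {a b : (ι → F) → F} (ha : a ∈ A) (hb : b ∈ A) : IsArithStep A (a * b) :=
  ⟨a, ha, b, hb, Or.inr (Or.inr (Or.inl rfl))⟩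

/-- Surplus steps compute 0 + 0, so operation counts may be treated as upper bounds. -/
theorem Derives.le (h0 : (fun _ => 0) ∈ A) (hst : s ≤ t) (H : Derives A s B) : Derives A t B := by
  obtain ⟨r, rfl⟩ := Nat.exists_eq_add_of_le hst
  refine ((H.trans (C := ∅) ?_)).mono subset_rfl Set.subset_union_left
  refine ⟨fun _ _ => 0, fun j _ => ?_, by simp⟩
  have : IsArithStep (A ∪ B) ((fun _ => 0) + fun _ => (0 : F)) :=
    .add (Set.mem_union_left _ h0) (Set.mem_union_left _ h0)
  rw [show ((fun _ => 0) + fun _ => (0 : F)) = fun _ : ι → F => (0 : F) by funext; simp] at this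
  exact this.mono Set.subset_union_left

/-- A linear combination of `n` available functions takes at most `2 n` operations. -/
theorem Derives.sum_mul {γ : Type*} (s : Finset γ) (c : γ → F) (u : γ → (ι → F) → F)
    (hc : ∀ r : F, (fun _ => r) ∈ A) (hu : ∀ i ∈ s, u i ∈ A) :
    Derives A (s.card * 2) {fun x => ∑ i ∈ s, c i * u i x} := by
  classical
  induction s using Finset.induction_on with
  | empty => exact Derives.of_subset (by simpa using hc 0)
  | insert a s ha ih =>
    rw [Finset.card_insert_of_notMem ha, add_mul, one_mul]
    refine (ih fun i hi => hu i (by simp [hi])).then ?_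
    have h1 : Derives (A ∪ {fun x => ∑ i ∈ s, c i * u i x}) 1 {(fun _ => c a) * u a} :=
      .step (.mul (Or.inl (hc (c a))) (Or.inl (hu a (by simp))))
    refine h1.then (t := 1) ?_
    have : (fun x => ∑ i ∈ insert a s, c i * u i x) =
        ((fun _ => c a) * u a) + fun x => ∑ i ∈ s, c i * u i x := by
      funext x; simp [Finset.sum_insert ha]
    rw [this]
    exact .step (.add (Or.inr rfl) (Or.inl (Or.inr rfl)))

/-- The inputs and the constants. -/
def inputsAndConstants (F : Type*) (ι : Type*) : Set ((ι → F) → F) :=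
  {h | (∃ i, h = fun x => x i) ∨ ∃ a : F, h = fun _ => a}

theorem availableAfter_eq (g : ℕ → (ι → F) → F) (t : ℕ) :
    availableAfter g t = inputsAndConstants F ι ∪ {h | ∃ j < t, h = g j} := by
  ext h
  simp only [availableAfter, inputsAndConstants, Set.mem_ofPred_eq, Set.mem_union, or_assoc]

theorem computableWithOps_iff {κ : Type*} {Φ : (ι → F) → (κ → F)} :
    ComputableWithOps t Φ ↔
      Derives (inputsAndConstants F ι) t (Set.range fun k x => Φ x k) := by
  simp only [ComputableWithOps, Derives, availableAfter_eq, Set.range_subset_iff]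

theorem input_mem (i : ι) : (fun x => x i) ∈ inputsAndConstants F ι := Or.inl ⟨i, rfl⟩

theorem constant_mem (a : F) : (fun _ => a) ∈ inputsAndConstants F ι := Or.inr ⟨a, rfl⟩

/-- Substituting available functions for the inputs of a computation. -/
theorem Derives.substitute {ν κ : Type*} {Φ : (ν → F) → (κ → F)} (H : ComputableWithOps t Φ)
    (hc : ∀ a : F, (fun _ => a) ∈ A) (u : ν → (ι → F) → F) (hu : ∀ i, u i ∈ A) :
    Derives A t (Set.range fun k x => Φ (fun i => u i x) k) := by
  obtain ⟨g, h1, h2⟩ := H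
  have key : ∀ r, ∀ h ∈ availableAfter g r, (fun x => h fun i => u i x) ∈
      A ∪ {h | ∃ j < r, h = fun x => g j fun i => u i x} := by
    rintro r h (⟨i, rfl⟩ | ⟨a, rfl⟩ | ⟨j, hj, rfl⟩)
    · exact Or.inl (hu i)
    · exact Or.inl (hc a)
    · exact Or.inr ⟨j, hj, rfl⟩
  refine ⟨fun j x => g j fun i => u i x, fun j hj => ?_, ?_⟩
  · obtain ⟨a, ha, b, hb, H⟩ := h1 j hj
    refine ⟨_, key j a ha, _, key j b hb, ?_⟩
    rcases H with H | H | H | ⟨H0, H⟩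
    · left; funext x; simp [H]
    · right; left; funext x; simp [H]
    · right; right; left; funext x; simp [H]
    -- A divisor without zeros has none after the substitution either.
    · right; right; right; exact ⟨fun x => H0 _, by funext x; simp [H]⟩
  · rintro _ ⟨k, rfl⟩
    exact key t _ (h2 k)

end Derives

/-! ### Matrix-vector products -/

section MatOps

universe u

variable {F : Type u} [Field F] {ι κ μ : Type} [Fintype ι] [Fintype κ] [Fintype μ]

/-- The product of the fixed matrix `A` with a vector can be computed with `t` operations. -/
structure MatOps (A : Matrix κ ι F) (t : ℕ) : Prop where
  -- The entries of the vector are arbitrary available functions, not only inputs; this makes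
  -- products composable.
  derives : ∀ {ν : Type} (S : Set ((ν → F) → F)), (∀ a : F, (fun _ => a) ∈ S) →
    ∀ x : ι → (ν → F) → F, (∀ i, x i ∈ S) →
      Derives S t (Set.range fun k y => ∑ i, A k i * x i y)

theorem MatOps.le {A : Matrix κ ι F} {s t : ℕ} (H : MatOps A s) (h : s ≤ t) : MatOps A t :=
  ⟨fun S hS x hx => (H.derives S hS x hx).le (hS 0) h⟩

theorem MatOps.naive (A : Matrix κ ι F) : MatOps A (Fintype.card κ * (Fintype.card ι * 2)) :=
  ⟨fun _ hS x hx => Derives.range _ fun k => Derives.sum_mul univ (A k) x hS fun i _ => hx i⟩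

theorem MatOps.mul {A : Matrix κ ι F} {B : Matrix ι μ F} {s t : ℕ} (hA : MatOps A s)
    (hB : MatOps B t) : MatOps (A * B) (t + s) := by
  refine ⟨fun {ν} S hS x hx => ?_⟩
  refine (hB.derives S hS x hx).then ?_
  convert hA.derives (S ∪ Set.range fun i y => ∑ j, B i j * x j y) (fun a => Or.inl (hS a)) _
    (fun i => Or.inr ⟨i, rfl⟩) using 3 with k
  funext y
  simp only [Matrix.mul_apply, Finset.sum_mul, Finset.mul_sum, mul_assoc]
  exact Finset.sum_comm

/-- Selecting rows and columns is free. -/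
theorem MatOps.submatrix {A : Matrix κ ι F} {t : ℕ} (hA : MatOps A t) {κ' ι' : Type} [Fintype ι']
    (e : κ' → κ) {f : ι' → ι} (hf : Function.Injective f) : MatOps (A.submatrix e f) t := by
  classical
  refine ⟨fun {ν} S hS x hx => ?_⟩
  -- Columns that are not selected receive the constant 0.
  have := hA.derives S hS (fun i => if h : ∃ i', f i' = i then x h.choose else fun _ => 0) fun i => by
    by_cases h : ∃ i', f i' = i
    · simp only [h, dite_true]; exact hx _
    · simp only [h, dite_false]; exact hS 0
  refine this.mono subset_rfl ?_
  rintro _ ⟨k, rfl⟩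
  refine ⟨e k, ?_⟩
  funext y
  beta_reduce
  rw [← Finset.sum_subset (Finset.subset_univ (univ.map ⟨f, hf⟩))]
  · simp only [Finset.sum_map, Function.Embedding.coeFn_mk, Matrix.submatrix_apply]
    refine Finset.sum_congr rfl fun i _ => ?_
    have h : ∃ i', f i' = f i := ⟨i, rfl⟩
    rw [dif_pos h, hf h.choose_spec]
  · intro i _ hi
    have h : ¬ ∃ i', f i' = i := by simpa using hi
    simp [dif_neg h]

theorem MatOps.diagonal [DecidableEq κ] (d : κ → F) :
    MatOps (Matrix.diagonal d) (Fintype.card κ) := by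
  refine ⟨fun {ν} S hS x hx => ?_⟩
  have := Derives.range (A := S) (t := 1) (fun k => (fun _ => d k) * x k) fun k =>
    Derives.step (.mul (hS _) (hx k))
  rw [mul_one] at this
  convert this using 3 with k
  funext y
  simp [Matrix.diagonal_apply]

theorem MatOps.blockDiagonal {o : Type} [Fintype o] [DecidableEq o] {A : o → Matrix κ ι F} {t : ℕ}
    (hA : ∀ i, MatOps (A i) t) : MatOps (Matrix.blockDiagonal A) (Fintype.card o * t) := by
  refine ⟨fun {ν} S hS x hx => ?_⟩
  have := Derives.iUnion (fun _ : o => t) _ fun c => (hA c).derives S hS (fun i => x (i, c)) fun i => hx _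
  simp only [Finset.sum_const, Finset.card_univ, smul_eq_mul] at this
  refine this.mono subset_rfl ?_
  rintro _ ⟨⟨k, c⟩, rfl⟩
  refine Set.mem_iUnion.mpr ⟨c, k, ?_⟩
  funext y
  simp [Matrix.blockDiagonal_apply, Fintype.sum_prod_type]

theorem MatOps.fromCols {A : Matrix κ ι F} {B : Matrix κ μ F} {s t : ℕ} (hA : MatOps A s)
    (hB : MatOps B t) : MatOps (Matrix.fromCols A B) (s + t + Fintype.card κ) := by
  refine ⟨fun {ν} S hS x hx => ?_⟩
  refine ((hA.derives S hS (fun i => x (.inl i)) fun i => hx _).union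
    (hB.derives S hS (fun i => x (.inr i)) fun i => hx _)).then ?_
  have := Derives.range (t := 1) (A := S ∪ (Set.range (fun k y => ∑ i, A k i * x (.inl i) y) ∪
    Set.range fun k y => ∑ i, B k i * x (.inr i) y))
    (fun k => (fun y => ∑ i, A k i * x (.inl i) y) + fun y => ∑ i, B k i * x (.inr i) y) fun k =>
    Derives.step (.add (Or.inr (Or.inl ⟨k, rfl⟩)) (Or.inr (Or.inr ⟨k, rfl⟩)))
  rw [mul_one] at this
  convert this using 3 with k
  funext y
  simp

theorem MatOps.fromRows {A : Matrix κ ι F} {B : Matrix μ ι F} {s t : ℕ} (hA : MatOps A s)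
    (hB : MatOps B t) : MatOps (Matrix.fromRows A B) (s + t) := by
  refine ⟨fun {ν} S hS x hx => ?_⟩
  refine ((hA.derives S hS x hx).union (hB.derives S hS x hx)).mono subset_rfl ?_
  rintro _ ⟨k | k, rfl⟩
  · exact Or.inl ⟨k, rfl⟩
  · exact Or.inr ⟨k, rfl⟩

/-- The products with `A` and with its transpose both take at most `t` operations. -/
def SymOps (A : Matrix κ ι F) (t : ℕ) : Prop := MatOps A t ∧ MatOps A.transpose t

theorem SymOps.le {A : Matrix κ ι F} {s t : ℕ} (H : SymOps A s) (h : s ≤ t) : SymOps A t :=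
  ⟨H.1.le h, H.2.le h⟩

theorem SymOps.naive (A : Matrix κ ι F) : SymOps A (Fintype.card κ * (Fintype.card ι * 2)) :=
  ⟨.naive A, (MatOps.naive A.transpose).le (le_of_eq (by ring))⟩

/-- Carrying the transpose along replaces the transposition principle: a factorization passes to the
transpose with its factors reversed. -/
theorem SymOps.mul {A : Matrix κ ι F} {B : Matrix ι μ F} {s t : ℕ} (hA : SymOps A s)
    (hB : SymOps B t) : SymOps (A * B) (s + t) := by
  refine ⟨(hA.1.mul hB.1).le (by omega), ?_⟩
  rw [Matrix.transpose_mul]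
  exact hB.2.mul hA.2

theorem SymOps.submatrix {A : Matrix κ ι F} {t : ℕ} (hA : SymOps A t) {κ' ι' : Type} [Fintype ι']
    [Fintype κ'] {e : κ' → κ} {f : ι' → ι} (he : Function.Injective e)
    (hf : Function.Injective f) : SymOps (A.submatrix e f) t :=
  ⟨hA.1.submatrix e hf, hA.2.submatrix f he⟩

theorem SymOps.fromCols {A : Matrix κ ι F} {B : Matrix κ μ F} {s t : ℕ} (hA : SymOps A s)
    (hB : SymOps B t) : SymOps (Matrix.fromCols A B) (s + t + Fintype.card κ) := by
  refine ⟨hA.1.fromCols hB.1, ?_⟩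
  rw [Matrix.transpose_fromCols]
  exact (hA.2.fromRows hB.2).le (by omega)

end MatOps

/-! ### Fast products with Hankel matrices -/

section Hankel

universe u

variable {F : Type u} [Field F]

/-- The square Hankel matrix with entries `h (i + j)`. -/
def hankel (n : ℕ) (h : ℕ → F) : Matrix (Fin n) (Fin n) F :=
  Matrix.of fun i j => h (i + j)

theorem hankel_transpose (n : ℕ) (h : ℕ → F) : (hankel n h).transpose = hankel n h := by
  ext i j
  simp [hankel, add_comm]

/-- A field with more than `M` elements has an element with `M` distinct powers. -/
theorem exists_injOn_pow (M : ℕ) (hM : ((M + 1 : ℕ) : ℕ∞) ≤ ENat.card F) :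
    ∃ g : F, g ≠ 0 ∧ Set.InjOn (fun r : ℕ => g ^ r) (Set.Iio M) := by
  classical
  rcases finite_or_infinite F with hF | hF
  · have := Fintype.ofFinite F
    -- A generator of the unit group has order |F| - 1 ≥ M.
    obtain ⟨g, hg⟩ := IsCyclic.exists_ofOrder_eq_natCard (α := Fˣ)
    refine ⟨g, g.ne_zero, fun a ha b hb hab => ?_⟩
    rw [ENat.card_eq_coe_natCard, Nat.cast_le] at hM
    have hcard : M ≤ orderOf g := by
      rw [hg, Nat.card_units]
      omega
    refine pow_injOn_Iio_orderOf (lt_of_lt_of_le ha hcard) (lt_of_lt_of_le hb hcard) ?_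
    exact Units.ext (by simpa using hab)
  -- In an infinite field it suffices to avoid 0 and the roots of unity of order at most M.
  · obtain ⟨g, hg⟩ := Infinite.exists_notMem_finset
      ((Polynomial.X * ∏ j ∈ range M, (Polynomial.X ^ (j + 1) - 1 : Polynomial F)).roots.toFinset)
    have hne : (Polynomial.X * ∏ j ∈ range M, (Polynomial.X ^ (j + 1) - 1 : Polynomial F)) ≠ 0 := by
      refine mul_ne_zero Polynomial.X_ne_zero (Finset.prod_ne_zero_iff.mpr fun j _ => ?_)
      exact (Polynomial.monic_X_pow_sub_C (1 : F) (Nat.succ_ne_zero j)).ne_zero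
    simp only [Multiset.mem_toFinset, Polynomial.mem_roots hne, Polynomial.IsRoot,
      Polynomial.eval_mul, Polynomial.eval_prod, Polynomial.eval_X, Polynomial.eval_sub,
      Polynomial.eval_pow, Polynomial.eval_one, mul_eq_zero, not_or, Finset.prod_eq_zero_iff,
      not_exists, not_and, Finset.mem_range, sub_eq_zero] at hg
    have key : ∀ a b : ℕ, a < b → b < M → g ^ a ≠ g ^ b := by
      intro a b hab hb h
      obtain ⟨d, rfl⟩ := Nat.exists_eq_add_of_lt hab
      refine hg.2 d (by omega) ?_
      rw [add_assoc, pow_add] at h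
      exact mul_left_cancel₀ (pow_ne_zero a hg.1) (by rw [← h, mul_one])
    refine ⟨g, hg.1, fun a ha b hb hab => ?_⟩
    rcases lt_trichotomy a b with h | h | h
    · exact absurd hab (key a b h hb)
    · exact h
    · exact absurd hab.symm (key b a h ha)

/-- A sequence of length `n` is a combination of `n` geometric ones with distinct ratios. -/
theorem exists_sum_geometric {n : ℕ} {v : Fin n → F} (hv : Function.Injective v) (c : ℕ → F) :
    ∃ u : Fin n → F, ∀ s < n, c s = ∑ r, u r * v r ^ s := by
  have hdet : IsUnit (Matrix.vandermonde v).det :=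
    isUnit_iff_ne_zero.mpr (Matrix.det_vandermonde_ne_zero_iff.mpr hv)
  refine ⟨Matrix.vecMul (fun s : Fin n => c s) (Matrix.vandermonde v)⁻¹, fun s hs => ?_⟩
  have := congrFun (Matrix.vecMul_vecMul (fun s : Fin n => c s) (Matrix.vandermonde v)⁻¹
    (Matrix.vandermonde v)) ⟨s, hs⟩
  rw [Matrix.nonsing_inv_mul _ hdet, Matrix.vecMul_one] at this
  simpa [Matrix.vecMul, dotProduct, Matrix.vandermonde] using this.symm

/-- This turns g^(r j) into a Hankel entry g^C(r+j,2) between two diagonal scalings. Binomial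
coefficients in place of halved squares avoid a square root of g. -/
theorem add_choose_two_eq (r j : ℕ) :
    (r + j).choose 2 = r.choose 2 + j.choose 2 + r * j := by
  induction j with
  | zero => simp
  | succ j ih =>
    rw [← add_assoc, Nat.choose_succ_succ' (r + j) 1, Nat.choose_succ_succ' j 1, ih]
    simp only [Nat.choose_one_right]
    ring

/-- Evaluation at a geometric progression costs as much as a product with a Hankel matrix
(Bluestein's algorithm). -/
theorem SymOps.geometric {g : F} (hg : g ≠ 0) {k q t : ℕ} (hq : q = 2 * k)
    (H : ∀ h : ℕ → F, MatOps (hankel q h) t) :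
    SymOps (Matrix.of fun (r : Fin q) (j : Fin k) => g ^ (r * j : ℕ)) (t + 2 * q) := by
  set d : Fin q → F := fun i => (g ^ (i : ℕ).choose 2)⁻¹
  have hH : SymOps (hankel q fun s => g ^ s.choose 2) t := ⟨H _, by
    rw [hankel_transpose]; exact H _⟩
  have hD : SymOps (Matrix.diagonal d) q := by
    have := MatOps.diagonal d
    rw [Fintype.card_fin] at this
    exact ⟨this, by rwa [Matrix.diagonal_transpose]⟩
  have hle : k ≤ q := by omega
  have := ((hD.mul hH).mul hD).submatrix (e := id) (f := Fin.castLE hle) Function.injective_id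
    (Fin.castLE_injective hle)
  refine SymOps.le ?_ (show q + t + q ≤ t + 2 * q by omega)
  convert this using 1
  ext r j
  simp only [Matrix.of_apply, Matrix.submatrix_apply, Matrix.mul_diagonal, Matrix.diagonal_mul,
    hankel, d, id_eq, Fin.val_castLE, add_choose_two_eq, pow_add]
  have h1 := pow_ne_zero ((r : ℕ).choose 2) hg
  have h2 := pow_ne_zero ((j : ℕ).choose 2) hg
  field_simp

/-- A Hankel matrix of size `k m` is reduced to Hankel matrices of the sizes `m` and `2 k`. -/
theorem hankel_recursion {g : F} (hg : g ≠ 0) {n k m q s t : ℕ} (hn : n = k * m) (hq : q = 2 * k)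
    (hinj : Set.InjOn (fun r : ℕ => g ^ r) (Set.Iio q))
    (Hm : ∀ h : ℕ → F, MatOps (hankel m h) s) (Hq : ∀ h : ℕ → F, MatOps (hankel q h) t)
    (h : ℕ → F) : MatOps (hankel n h) (2 * (m * (t + 2 * q)) + q * s) := by
  subst hn
  have hv : Function.Injective fun r : Fin q => g ^ (r : ℕ) := fun a b hab =>
    Fin.ext (hinj a.2 b.2 hab)
  -- Indices are written as i1 + m i2 with i1 < m and i2 < k. An entry is h (x + m y) with x = i1 +
  -- j1 and y = i2 + j2 < 2 k = q, so for each x only q values matter and q geometric sequences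
  -- suffice.
  choose u hu using fun x : ℕ => exists_sum_geometric hv fun y => h (x + m * y)
  have hV := SymOps.geometric hg hq Hq
  set V := Matrix.of fun (r : Fin q) (j : Fin k) => g ^ (r * j : ℕ)
  -- Since g^(r (i2 + j2)) splits into two factors, the matrix is the product of m transforms `V`, q
  -- Hankel matrices of size m (one for each ratio), and m transposed transforms.
  have h1 : MatOps (Matrix.blockDiagonal fun _ : Fin m => V) _ := .blockDiagonal fun _ => hV.1
  have h2 : MatOps (Matrix.blockDiagonal fun r : Fin q => hankel m fun x => u x r) _ :=
    .blockDiagonal fun r => Hm _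
  have h3 : MatOps (Matrix.blockDiagonal fun _ : Fin m => V.transpose) _ :=
    .blockDiagonal fun _ => hV.2
  have h4 := ((h3.mul ((h2.submatrix (Equiv.prodComm (Fin q) (Fin m))
    (Equiv.prodComm (Fin q) (Fin m)).injective).mul h1)).submatrix finProdFinEquiv.symm
      (finProdFinEquiv (m := k) (n := m)).symm.injective)
  simp only [Fintype.card_fin] at h4
  refine MatOps.le ?_ (le_of_eq (show m * (t + 2 * q) + q * s + m * (t + 2 * q) = _ by ring))
  convert h4 using 1
  ext i j
  obtain ⟨⟨i2, i1⟩, rfl⟩ := finProdFinEquiv.surjective i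
  obtain ⟨⟨j2, j1⟩, rfl⟩ := finProdFinEquiv.surjective j
  have hlt : (i2 + j2 : ℕ) < q := by omega
  have := hu (i1 + j1) _ hlt
  simp only [hankel, Matrix.of_apply, finProdFinEquiv_apply_val, Matrix.submatrix_apply,
    Equiv.symm_apply_apply, Matrix.mul_apply, Fintype.sum_prod_type, Matrix.blockDiagonal_apply,
    Equiv.prodComm_apply, Prod.swap_prod_mk, Matrix.transpose_apply, V]
  rw [show (i1 + m * i2 + (j1 + m * j2) : ℕ) = i1 + j1 + m * (i2 + j2) by ring, this]
  simp only [ite_mul, zero_mul, mul_ite, mul_zero, Finset.sum_ite_eq, Finset.sum_ite_eq',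
    Finset.mem_univ, if_true]
  refine Finset.sum_congr rfl fun r _ => ?_
  rw [← pow_mul, mul_add, pow_add]
  ring

/-- Balanced splitting of the exponent: with τ(e) the cost divided by 2^e, the recursion reads τ(e)
≤ 4 τ(b + 1) + 2 τ(a) + 8, where b = ⌊e/2⌋ and a = e - b. Only 2^(e-2) distinct powers of g are
required, fewer than the size of the matrix, because the field may be small. -/
theorem hankelOps {g : F} (hg : g ≠ 0) {M : ℕ} (hinj : Set.InjOn (fun r : ℕ => g ^ r) (Set.Iio M))
    (e : ℕ) (he : 8 ≤ e → 2 ^ (e - 2) ≤ M) (h : ℕ → F) :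
    MatOps (hankel (2 ^ e) h) (256 * 2 ^ e * (e + 1) ^ 5) := by
  induction e using Nat.strong_induction_on generalizing h with
  | _ e ih =>
    by_cases he8 : e < 8
    -- For e ≤ 7 the naive count is at most 2^e * 256; this fixes the constant 256.
    · refine (MatOps.naive _).le ?_
      simp only [Fintype.card_fin]
      have : 2 ^ e ≤ 128 := Nat.pow_le_pow_right (n := 2) (by norm_num) (show e ≤ 7 by omega)
      calc 2 ^ e * (2 ^ e * 2) ≤ 2 ^ e * (128 * 2) := by gcongr
        _ = 256 * 2 ^ e * 1 ^ 5 := by ring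
        _ ≤ _ := by gcongr; omega
    · push Not at he8
      obtain ⟨b, hb⟩ : ∃ b, b = e / 2 := ⟨_, rfl⟩
      obtain ⟨a, ha⟩ : ∃ a, a = e - b := ⟨_, rfl⟩
      have hM := he he8
      have hmono : ∀ x y, x ≤ y → (2 : ℕ) ^ x ≤ 2 ^ y := fun x y => Nat.pow_le_pow_right (by norm_num)
      have Ha := fun h => ih a (by omega) (fun _ => (hmono _ _ (by omega)).trans hM) h
      have Hb := fun h => ih (b + 1) (by omega) (fun _ => (hmono _ _ (by omega)).trans hM) h
      have hab : e = b + a := by omega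
      refine (hankel_recursion hg (n := 2 ^ e) (k := 2 ^ b) (m := 2 ^ a) (by rw [hab, pow_add])
        (by rw [pow_succ, mul_comm]) (hinj.mono ?_) Ha Hb h).le ?_
      · intro x hx
        exact lt_of_lt_of_le (Set.mem_Iio.mp hx) ((hmono _ _ (by omega)).trans hM)
      -- For e ≥ 8 both smaller exponents plus one are at most 2/3 of e + 1. The power 5 is the
      -- first one with 6 (2/3)^5 < 1.
      · have e1 : (3 * (b + 2)) ^ 5 ≤ (2 * (e + 1)) ^ 5 := Nat.pow_le_pow_left (by omega) 5
        have e2 : (3 * (a + 1)) ^ 5 ≤ (2 * (e + 1)) ^ 5 := Nat.pow_le_pow_left (by omega) 5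
        have e3 : 1 ≤ (e + 1) ^ 5 := Nat.one_le_pow _ _ (by omega)
        rw [mul_pow, mul_pow] at e1 e2
        have e4 : 1024 * (b + 2) ^ 5 + 512 * (a + 1) ^ 5 + 8 ≤ 256 * (e + 1) ^ 5 := by omega
        calc _ = 2 ^ (b + a) * (1024 * (b + 2) ^ 5 + 512 * (a + 1) ^ 5 + 8) := by ring
          _ ≤ 2 ^ (b + a) * (256 * (e + 1) ^ 5) := by gcongr
          _ = _ := by rw [hab]; ring

end Hankel

/-! ### Fast products with Cauchy matrices -/

section Cauchy

universe u

variable {F : Type u} [Field F]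

/-- Products over the full type can be reindexed and split along sums of types. -/
theorem prod_univ_erase_eq_ite {ι M : Type*} [Fintype ι] [DecidableEq ι] [CommMonoid M] (i : ι)
    (f : ι → M) : ∏ j ∈ univ.erase i, f j = ∏ j, if j = i then 1 else f j := by
  rw [← Finset.mul_prod_erase univ _ (Finset.mem_univ i), if_pos rfl, one_mul]
  exact Finset.prod_congr rfl fun j hj => by rw [if_neg (Finset.ne_of_mem_erase hj)]

/-- The columns are the coefficients of the polynomials `∏_{j ≠ i} (X - a_j)`. -/
def nodalMatrix {ι : Type} [Fintype ι] [DecidableEq ι] (n : ℕ) (a : ι → F) :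
    Matrix (Fin n) ι F :=
  Matrix.of fun p i => (Lagrange.nodal (univ.erase i) a).coeff p

theorem natDegree_nodal_erase_lt {ι : Type} [Fintype ι] [DecidableEq ι] (a : ι → F) (i : ι) {n : ℕ}
    (hn : Fintype.card ι ≤ n) : (Lagrange.nodal (univ.erase i) a).natDegree < n := by
  rw [Lagrange.natDegree_nodal, Finset.card_erase_of_mem (Finset.mem_univ i), Finset.card_univ]
  have : 0 < Fintype.card ι := Fintype.card_pos_iff.mpr ⟨i⟩
  omega

theorem sum_nodalMatrix_mul_pow {ι : Type} [Fintype ι] [DecidableEq ι] (a : ι → F) (i : ι) {n : ℕ}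
    (hn : Fintype.card ι ≤ n) (x : F) :
    ∑ p : Fin n, nodalMatrix n a p i * x ^ (p : ℕ) =
      (Lagrange.nodal (univ.erase i) a).eval x := by
  rw [Polynomial.eval_eq_sum_range' (natDegree_nodal_erase_lt a i hn), ← Fin.sum_univ_eq_sum_range
    (fun p => (Lagrange.nodal (univ.erase i) a).coeff p * x ^ p)]
  rfl

theorem nodalMatrix_comp_equiv {ι κ : Type} [Fintype ι] [DecidableEq ι] [Fintype κ] [DecidableEq κ]
    (n : ℕ) (a : ι → F) (e : κ ≃ ι) :
    nodalMatrix n (a ∘ e) = (nodalMatrix n a).submatrix id e := by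
  ext p i
  simp only [nodalMatrix, Matrix.of_apply, Matrix.submatrix_apply, id_eq, Lagrange.nodal,
    prod_univ_erase_eq_ite]
  congr 1
  exact Fintype.prod_equiv e _ _ fun j => by simp

/-- The matrix of the multiplication by `Q`. -/
def mulMatrix (m n : ℕ) (Q : Polynomial F) : Matrix (Fin m) (Fin n) F :=
  Matrix.of fun p q => if q.val ≤ p.val then Q.coeff (p - q) else 0

theorem sum_mulMatrix_mul_coeff {m n : ℕ} (Q P : Polynomial F) (hP : P.natDegree < n) (p : Fin m) :
    ∑ q : Fin n, mulMatrix m n Q p q * P.coeff q = (Q * P).coeff p := by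
  rw [mul_comm Q, Polynomial.coeff_mul, Finset.Nat.sum_antidiagonal_eq_sum_range_succ
    (fun i j => P.coeff i * Q.coeff j)]
  simp only [mulMatrix, Matrix.of_apply]
  rw [Fin.sum_univ_eq_sum_range
    (fun q => (if q ≤ p.val then Q.coeff (p - q) else 0) * P.coeff q) n]
  rw [← Finset.sum_subset (s₁ := range n ∩ range (p + 1)) Finset.inter_subset_left,
    ← Finset.sum_subset (s₁ := range n ∩ range (p + 1)) (s₂ := range (p + 1))
      Finset.inter_subset_right]
  · refine Finset.sum_congr rfl fun q hq => ?_
    have : q ≤ p.val := by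
      have := (Finset.mem_inter.mp hq).2
      simp only [Finset.mem_range] at this
      omega
    rw [if_pos this, mul_comm]
  · intro q hq hq'
    simp only [Finset.mem_inter, Finset.mem_range, not_and] at hq hq'
    rw [Polynomial.coeff_eq_zero_of_natDegree_lt (p := P) (by omega), zero_mul]
  · intro q hq hq'
    simp only [Finset.mem_inter, Finset.mem_range, not_and] at hq hq'
    rw [if_neg (by have := hq' hq; omega), zero_mul]

/-- Reversing the order of the columns turns a Toeplitz matrix into a Hankel matrix; the shift by m
- 1 keeps the indices nonnegative. -/
theorem SymOps.mulMatrix {m n t : ℕ} (hn : n ≤ m) (H : ∀ h : ℕ → F, MatOps (hankel m h) t)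
    (Q : Polynomial F) : SymOps (mulMatrix m n Q) t := by
  set h : ℕ → F := fun s => if m - 1 ≤ s then Q.coeff (s - (m - 1)) else 0
  have hH : SymOps (hankel m h) t := ⟨H _, by rw [hankel_transpose]; exact H _⟩
  have := hH.submatrix (e := id) (f := fun q : Fin n => Fin.rev (Fin.castLE hn q))
    Function.injective_id (Fin.rev_injective.comp (Fin.castLE_injective hn))
  convert this using 1
  ext p q
  simp only [_root_.mulMatrix, hankel, Matrix.of_apply, Matrix.submatrix_apply, id_eq, Fin.val_rev,
    Fin.val_castLE, h]
  have hp := p.2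
  have hq := q.2
  by_cases hqp : q.val ≤ p.val
  · rw [if_pos hqp, if_pos (by omega)]
    congr 1
    omega
  · rw [if_neg hqp, if_neg (by omega)]

/-- The divide and conquer step: omitting a node from one half leaves the full nodal polynomial of
the other half as a factor. -/
theorem nodalMatrix_sum {ι κ : Type} [Fintype ι] [DecidableEq ι] [Fintype κ] [DecidableEq κ]
    {m n : ℕ} (hι : Fintype.card ι ≤ n) (hκ : Fintype.card κ ≤ n) (a : ι ⊕ κ → F) :
    nodalMatrix m a = Matrix.fromCols
      (mulMatrix m n (Lagrange.nodal univ (a ∘ Sum.inr)) * nodalMatrix n (a ∘ Sum.inl))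
      (mulMatrix m n (Lagrange.nodal univ (a ∘ Sum.inl)) * nodalMatrix n (a ∘ Sum.inr)) := by
  ext p (i | i)
  · rw [Matrix.fromCols_apply_inl, Matrix.mul_apply]
    simp only [nodalMatrix, Matrix.of_apply]
    rw [sum_mulMatrix_mul_coeff _ _ (natDegree_nodal_erase_lt _ _ hι)]
    simp only [Lagrange.nodal, prod_univ_erase_eq_ite, Fintype.prod_sum_type]
    simp [mul_comm]
  · rw [Matrix.fromCols_apply_inr, Matrix.mul_apply]
    simp only [nodalMatrix, Matrix.of_apply]
    rw [sum_mulMatrix_mul_coeff _ _ (natDegree_nodal_erase_lt _ _ hκ)]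
    simp only [Lagrange.nodal, prod_univ_erase_eq_ite, Fintype.prod_sum_type]
    simp

/-- Each halving costs two polynomial multiplications and one addition of vectors, whence 513 = 2 *
256 + 1; the e levels contribute the sixth factor e + 1. -/
theorem SymOps.nodalMatrix (e : ℕ)
    (H : ∀ e' ≤ e, ∀ h : ℕ → F, MatOps (hankel (2 ^ e') h) (256 * 2 ^ e' * (e' + 1) ^ 5))
    {ι : Type} [Fintype ι] [DecidableEq ι] (a : ι → F) (hι : Fintype.card ι ≤ 2 ^ e) :
    SymOps (nodalMatrix (2 ^ e) a) (513 * 2 ^ e * (e + 1) ^ 6) := by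
  induction e generalizing ι with
  | zero =>
    refine (SymOps.naive _).le ?_
    simp only [Fintype.card_fin]
    omega
  | succ e ih =>
    have h1 : Fintype.card ι / 2 ≤ 2 ^ e := by rw [pow_succ] at hι; omega
    have h2 : Fintype.card ι - Fintype.card ι / 2 ≤ 2 ^ e := by rw [pow_succ] at hι; omega
    let E : Fin (Fintype.card ι / 2) ⊕ Fin (Fintype.card ι - Fintype.card ι / 2) ≃ ι :=
      Fintype.equivOfCardEq (by simp only [Fintype.card_sum, Fintype.card_fin]; omega)
    have hle : 2 ^ e ≤ 2 ^ (e + 1) := Nat.pow_le_pow_right (by norm_num) (by omega)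
    have H' : ∀ e' ≤ e, ∀ h : ℕ → F, MatOps (hankel (2 ^ e') h) (256 * 2 ^ e' * (e' + 1) ^ 5) :=
      fun e' he' => H e' (he'.trans (Nat.le_succ e))
    have hT := SymOps.mulMatrix hle (H (e + 1) le_rfl)
    have hS : SymOps (_root_.nodalMatrix (2 ^ (e + 1)) (a ∘ E))
        (256 * 2 ^ (e + 1) * (e + 1 + 1) ^ 5 + 513 * 2 ^ e * (e + 1) ^ 6 +
          (256 * 2 ^ (e + 1) * (e + 1 + 1) ^ 5 + 513 * 2 ^ e * (e + 1) ^ 6) +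
          Fintype.card (Fin (2 ^ (e + 1)))) := by
      rw [nodalMatrix_sum (n := 2 ^ e) (by simpa using h1) (by simpa using h2) (a ∘ E)]
      exact ((hT _).mul (ih H' _ (by simpa using h1))).fromCols
        ((hT _).mul (ih H' _ (by simpa using h2)))
    have hS' := hS.submatrix (e := id) Function.injective_id E.symm.injective
    rw [← nodalMatrix_comp_equiv] at hS'
    have hE : (a ∘ E) ∘ E.symm = a := by funext i; simp
    rw [hE] at hS'
    refine hS'.le ?_
    rw [Fintype.card_fin]
    have e1 : 1 ≤ (e + 1 + 1) ^ 5 := Nat.one_le_pow _ _ (by omega)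
    have e2 : (e + 1) ^ 6 ≤ (e + 1) * (e + 1 + 1) ^ 5 := by
      rw [pow_succ, mul_comm]; gcongr; omega
    calc _ = 2 ^ (e + 1) * (513 * (e + 1) ^ 6 + 512 * (e + 1 + 1) ^ 5 + 1) := by ring
      _ ≤ 2 ^ (e + 1) * (513 * ((e + 1) * (e + 1 + 1) ^ 5) + 512 * (e + 1 + 1) ^ 5 +
          (e + 1 + 1) ^ 5) := by gcongr
      _ = _ := by ring

/-- A Hankel matrix of moments represents the bilinear form ∑ c_j A(x_j) B(x_j) on coefficient
vectors. -/
theorem sum_mul_sum_geometric {κ : Type*} [Fintype κ] {n : ℕ} (A B : Fin n → F) (c x : κ → F) :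
    ∑ p : Fin n, A p * ∑ q : Fin n, (∑ j, c j * x j ^ (p + q : ℕ)) * B q =
      ∑ j, c j * ((∑ p, A p * x j ^ (p : ℕ)) * ∑ q, B q * x j ^ (q : ℕ)) := by
  have h : ∀ p : Fin n, ∑ q : Fin n, (∑ j, c j * x j ^ (p + q : ℕ)) * B q =
      ∑ j, c j * x j ^ (p : ℕ) * ∑ q, B q * x j ^ (q : ℕ) := by
    intro p
    simp_rw [Finset.sum_mul, Finset.mul_sum]
    rw [Finset.sum_comm]
    refine Finset.sum_congr rfl fun j _ => Finset.sum_congr rfl fun q _ => ?_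
    rw [pow_add]
    ring
  simp_rw [h]
  rw [Finset.sum_congr rfl fun p _ => Finset.mul_sum _ _ _, Finset.sum_comm]
  refine Finset.sum_congr rfl fun j _ => ?_
  rw [Finset.sum_mul, Finset.mul_sum]
  refine Finset.sum_congr rfl fun p _ => ?_
  ring

/-- Products with diagonally scaled Cauchy matrices take quasilinear time. -/
theorem cauchyOps (e : ℕ)
    (H : ∀ e' ≤ e, ∀ h : ℕ → F, MatOps (hankel (2 ^ e') h) (256 * 2 ^ e' * (e' + 1) ^ 5))
    {ι κ : Type} [Fintype ι] [Fintype κ] (a : ι → F) (b : κ → F) (hb : Function.Injective b)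
    (hab : ∀ i j, a i ≠ b j) (hι : Fintype.card ι ≤ 2 ^ e) (hκ : Fintype.card κ ≤ 2 ^ e)
    (d : κ → F) (d' : ι → F) :
    MatOps (Matrix.of fun j i => d j * (a i - b j)⁻¹ * d' i) (1290 * 2 ^ e * (e + 1) ^ 6) := by
  classical
  have hNa := (SymOps.nodalMatrix e H a hι).1
  have hNb := (SymOps.nodalMatrix e H b hκ).2
  set w : κ → F := fun j => (Lagrange.nodal (univ.erase j) b).eval (b j) with hw
  have hw0 : ∀ j, w j ≠ 0 := fun j => by
    simp only [hw, Lagrange.eval_nodal, Finset.prod_ne_zero_iff, sub_ne_zero]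
    exact fun i hi h => Finset.ne_of_mem_erase hi (hb h).symm
  -- With the weights 1 / w_j, pairing a polynomial with ∏_{j' ≠ j} (X - b_{j'}) yields its value at
  -- b_j. So multipoint evaluation is a Hankel product followed by a transposed nodal matrix.
  set G : ℕ → F := fun s => ∑ j, (w j)⁻¹ * b j ^ s
  have hne : ∀ j, (Lagrange.nodal univ a).eval (b j) ≠ 0 := fun j => by
    simp only [Lagrange.eval_nodal, Finset.prod_ne_zero_iff, sub_ne_zero]
    exact fun i _ h => hab i j h.symm
  have hprod : ∀ j i, ((nodalMatrix (2 ^ e) b).transpose * (hankel (2 ^ e) G *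
      nodalMatrix (2 ^ e) a)) j i = (Lagrange.nodal (univ.erase i) a).eval (b j) := by
    intro j i
    have : ∀ j', (Lagrange.nodal (univ.erase j) b).eval (b j') = if j' = j then w j else 0 := by
      intro j'
      split_ifs with h
      · rw [h]
      · exact Lagrange.eval_nodal_at_node (Finset.mem_erase.mpr ⟨h, Finset.mem_univ _⟩)
    calc _ = ∑ j', (w j')⁻¹ * ((∑ p, nodalMatrix (2 ^ e) b p j * b j' ^ (p : ℕ)) *
          ∑ q, nodalMatrix (2 ^ e) a q i * b j' ^ (q : ℕ)) := by
          simp only [Matrix.mul_apply, Matrix.transpose_apply, hankel, Matrix.of_apply, G]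
          exact sum_mul_sum_geometric _ _ _ _
      _ = _ := by
          simp only [sum_nodalMatrix_mul_pow b j hκ, sum_nodalMatrix_mul_pow a i hι, this]
          simp [hw0]
  -- Dividing ∏_{i' ≠ i} (b_j - a_{i'}) by the full product leaves (b_j - a_i)⁻¹, hence the sign.
  have hD := MatOps.diagonal fun j => d j * -((Lagrange.nodal univ a).eval (b j))⁻¹
  have := (hD.mul (hNb.mul ((H e le_rfl G).mul hNa))).mul (MatOps.diagonal d')
  have := this.le (t := 2 ^ e + (513 * 2 ^ e * (e + 1) ^ 6 + 256 * 2 ^ e * (e + 1) ^ 5 +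
    513 * 2 ^ e * (e + 1) ^ 6 + 2 ^ e)) (by gcongr)
  refine MatOps.le (s := 2 ^ e + (513 * 2 ^ e * (e + 1) ^ 6 + 256 * 2 ^ e * (e + 1) ^ 5 +
    513 * 2 ^ e * (e + 1) ^ 6 + 2 ^ e)) ?_ ?_
  · convert this using 1
    ext j i
    rw [Matrix.mul_diagonal, Matrix.diagonal_mul, hprod]
    have h1 : (Lagrange.nodal univ a).eval (b j) =
        (b j - a i) * (Lagrange.nodal (univ.erase i) a).eval (b j) := by
      simp only [Lagrange.eval_nodal]
      rw [Finset.mul_prod_erase univ (fun i => b j - a i) (Finset.mem_univ i)]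
    have h2 := hne j
    rw [h1] at h2 ⊢
    have h3 : (a i - b j) = -(b j - a i) := by ring
    have h4 := left_ne_zero_of_mul h2
    have h5 := right_ne_zero_of_mul h2
    rw [Matrix.of_apply, h3]
    field_simp
  · have e1 : 1 ≤ (e + 1) ^ 6 := Nat.one_le_pow _ _ (by omega)
    have e2 : (e + 1) ^ 5 ≤ (e + 1) ^ 6 := Nat.pow_le_pow_right (by omega) (by omega)
    calc _ = 2 ^ e * (1026 * (e + 1) ^ 6 + 256 * (e + 1) ^ 5 + 2) := by ring
      _ ≤ 2 ^ e * (1026 * (e + 1) ^ 6 + 256 * (e + 1) ^ 6 + 2 * (e + 1) ^ 6) := by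
        gcongr; omega
      _ ≤ 2 ^ e * (1290 * (e + 1) ^ 6) := by gcongr; omega
      _ = _ := by ring

end Cauchy

/-! ### Decoding by interpolation -/

section Recovery

universe u

variable {F : Type u} [Field F] {S ℓ K : ℕ}

/-- The threshold as a degree bound plus one: K (ℓ - 1) from clearing the denominators of the other
groups, N (K - 1) from N share polynomials. -/
theorem ncsaThreshold_eq {N ℓ K : ℕ} (hℓ : 1 ≤ ℓ) (hK : 1 ≤ K) :
    ncsaThreshold N ℓ K = K * (ℓ - 1) + N * (K - 1) + 1 := by
  obtain ⟨l, rfl⟩ := Nat.exists_eq_add_of_le' hℓ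
  obtain ⟨k, rfl⟩ := Nat.exists_eq_add_of_le' hK
  simp only [ncsaThreshold, Nat.add_sub_cancel]
  have : N + (l + 1) - 1 = N + l := by omega
  rw [this]
  have : (k + 1) * (N + l) = (k + 1) * l + N * k + N := by ring
  omega

theorem DistinctPoints.injective {f : Fin ℓ → Fin K → F} {α : Fin S → F}
    (h : DistinctPoints f α) : Function.Injective α :=
  h.comp Sum.inr_injective

theorem DistinctPoints.injective_left {f : Fin ℓ → Fin K → F} {α : Fin S → F}
    (h : DistinctPoints f α) {l l' : Fin ℓ} {k k' : Fin K} (e : f l k = f l' k') :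
    l = l' ∧ k = k' := by
  have := h (a₁ := Sum.inl (l, k)) (a₂ := Sum.inl (l', k')) e
  simpa using this

theorem DistinctPoints.ne {f : Fin ℓ → Fin K → F} {α : Fin S → F}
    (h : DistinctPoints f α) (l : Fin ℓ) (k : Fin K) (s : Fin S) : f l k ≠ α s := fun e => by
  simpa using h (a₁ := Sum.inl (l, k)) (a₂ := Sum.inr s) e

theorem DistinctPoints.csaDelta_ne_zero {f : Fin ℓ → Fin K → F} {α : Fin S → F}
    (h : DistinctPoints f α) (l : Fin ℓ) (s : Fin S) : csaDelta f α l s ≠ 0 :=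
  Finset.prod_ne_zero_iff.mpr fun k _ => sub_ne_zero.mpr (h.ne l k s)

/-- The product `∏_{k' ≠ k} (f_{l,k'} - f_{l,k})`. -/
def csaNorm (f : Fin ℓ → Fin K → F) (l : Fin ℓ) (k : Fin K) : F :=
  ∏ k' ∈ univ.erase k, (f l k' - f l k)

theorem DistinctPoints.csaNorm_ne_zero {f : Fin ℓ → Fin K → F} {α : Fin S → F}
    (h : DistinctPoints f α) (l : Fin ℓ) (k : Fin K) : csaNorm f l k ≠ 0 :=
  Finset.prod_ne_zero_iff.mpr fun _ hk' =>
    sub_ne_zero.mpr fun e => Finset.ne_of_mem_erase hk' (h.injective_left e).2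

/-- The product `∏_{k' ≠ k} (f_{l,k'} - X)`. -/
def shareBasis (f : Fin ℓ → Fin K → F) (l : Fin ℓ) (k : Fin K) : Polynomial F :=
  ∏ k' ∈ univ.erase k, (Polynomial.C (f l k') - Polynomial.X)

theorem natDegree_C_sub_X_le (a : F) : (Polynomial.C a - Polynomial.X).natDegree ≤ 1 := by
  compute_degree

theorem natDegree_prod_C_sub_X_le {ι : Type*} (s : Finset ι) (v : ι → F) :
    (∏ i ∈ s, (Polynomial.C (v i) - Polynomial.X)).natDegree ≤ s.card := by
  refine (Polynomial.natDegree_prod_le _ _).trans ?_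
  refine (Finset.sum_le_card_nsmul _ _ 1 fun i _ => natDegree_C_sub_X_le _).trans (by simp)

theorem natDegree_shareBasis_le (f : Fin ℓ → Fin K → F) (l : Fin ℓ) (k : Fin K) :
    (shareBasis f l k).natDegree ≤ K - 1 := by
  refine (natDegree_prod_C_sub_X_le _ _).trans (le_of_eq ?_)
  rw [Finset.card_erase_of_mem (Finset.mem_univ k), Finset.card_univ, Fintype.card_fin]

/-- The polynomial whose value at `α_s` is a share of server `s`. -/
def sharePoly (f : Fin ℓ → Fin K → F) (l : Fin ℓ) (x : Fin K → F) : Polynomial F :=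
  ∑ k, Polynomial.C (x k) * shareBasis f l k

theorem natDegree_sharePoly_le (f : Fin ℓ → Fin K → F) (l : Fin ℓ) (x : Fin K → F) :
    (sharePoly f l x).natDegree ≤ K - 1 :=
  Polynomial.natDegree_sum_le_of_forall_le _ _ fun k _ =>
    (Polynomial.natDegree_C_mul_le _ _).trans (natDegree_shareBasis_le f l k)

theorem eval_shareBasis_self (f : Fin ℓ → Fin K → F) (l : Fin ℓ) (k : Fin K) :
    (shareBasis f l k).eval (f l k) = csaNorm f l k := by
  simp [shareBasis, csaNorm, Polynomial.eval_prod]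

theorem eval_shareBasis_of_ne (f : Fin ℓ → Fin K → F) (l : Fin ℓ) {k k' : Fin K} (h : k' ≠ k) :
    (shareBasis f l k').eval (f l k) = 0 := by
  rw [shareBasis, Polynomial.eval_prod]
  exact Finset.prod_eq_zero (Finset.mem_erase.mpr ⟨h.symm, Finset.mem_univ _⟩) (by simp)

theorem eval_sharePoly_self (f : Fin ℓ → Fin K → F) (l : Fin ℓ) (x : Fin K → F) (k : Fin K) :
    (sharePoly f l x).eval (f l k) = csaNorm f l k * x k := by
  rw [sharePoly, Polynomial.eval_finsetSum, Finset.sum_eq_single k]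
  · rw [Polynomial.eval_mul, Polynomial.eval_C, eval_shareBasis_self, mul_comm]
  · intro k' _ h
    rw [Polynomial.eval_mul, eval_shareBasis_of_ne f l h, mul_zero]
  · simp

/-- The factor f_{l,k} - α_s of Δ_s^l cancels the pole of the k-th summand. -/
theorem DistinctPoints.csaShare_eq {f : Fin ℓ → Fin K → F} {α : Fin S → F}
    (h : DistinctPoints f α) {d : ℕ} (s : Fin S) (x : Fin (ℓ * K) → Fin d → F) (l : Fin ℓ)
    (i : Fin d) : csaShare f α s x (l, i) =
      (sharePoly f l fun k => x (finProdFinEquiv (l, k)) i).eval (α s) := by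
  simp only [csaShare, sharePoly, Polynomial.eval_finsetSum, Polynomial.eval_mul,
    Polynomial.eval_C, Finset.mul_sum, shareBasis, Polynomial.eval_prod, Polynomial.eval_sub,
    Polynomial.eval_X]
  refine Finset.sum_congr rfl fun k _ => ?_
  rw [csaDelta, ← Finset.mul_prod_erase univ _ (Finset.mem_univ k)]
  have := sub_ne_zero.mpr (h.ne l k s)
  field_simp

/-- The value at `f_{l,k}` of the factor in front of the group `l` in the interpolated
polynomial. -/
def csaScale (f : Fin ℓ → Fin K → F) (N : ℕ) (l : Fin ℓ) (k : Fin K) : F :=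
  (∏ l' ∈ univ.erase l, ∏ k', (f l' k' - f l k)) * csaNorm f l k ^ N

theorem DistinctPoints.prod_erase_ne_zero {f : Fin ℓ → Fin K → F} {α : Fin S → F}
    (h : DistinctPoints f α) (l : Fin ℓ) (k : Fin K) :
    ∏ l' ∈ univ.erase l, ∏ k', (f l' k' - f l k) ≠ 0 :=
  Finset.prod_ne_zero_iff.mpr fun _ hl' => Finset.prod_ne_zero_iff.mpr fun _ _ =>
    sub_ne_zero.mpr fun e => Finset.ne_of_mem_erase hl' (h.injective_left e).1

/-- The decoders of N-CSA codes: interpolation at the points of the responsive servers. -/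
def csaDecoder (f : Fin ℓ → Fin K → F) (α : Fin S → F) (N w : ℕ) :
    DecoderFamily F S (ℓ * K) w := fun T y a j =>
  (csaScale f N (finProdFinEquiv.symm a).1 (finProdFinEquiv.symm a).2)⁻¹ *
    (Lagrange.interpolate T α fun s =>
      (if h : s ∈ T then y ⟨s, h⟩ j else 0) * ∏ l, csaDelta f α l s).eval
        (f (finProdFinEquiv.symm a).1 (finProdFinEquiv.symm a).2)

/-- The polynomials `H l` are left arbitrary so that multilinear maps and polynomial maps share one
decoding argument. -/
theorem DistinctPoints.csaDecoder_eq {f : Fin ℓ → Fin K → F} {α : Fin S → F}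
    (h : DistinctPoints f α) (hℓ : 1 ≤ ℓ) (hK : 1 ≤ K) {N w : ℕ} {T : Finset (Fin S)}
    (hT : T.card = ncsaThreshold N ℓ K) (H : Fin ℓ → Polynomial F)
    (hH : ∀ l, (H l).natDegree ≤ N * (K - 1)) (y : T → Fin w → F) (j : Fin w)
    (hy : ∀ s : T, y s j = ∑ l, (csaDelta f α l s)⁻¹ * (H l).eval (α s)) (l : Fin ℓ) (k : Fin K) :
    csaDecoder f α N w T y (finProdFinEquiv (l, k)) j =
      (H l).eval (f l k) / csaNorm f l k ^ N := by
  -- At α_s this is the product of the Δ of the other groups.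
  set E : Fin ℓ → Polynomial F := fun l =>
    ∏ l' ∈ univ.erase l, ∏ k', (Polynomial.C (f l' k') - Polynomial.X)
  have hE : ∀ l, (E l).natDegree ≤ K * (ℓ - 1) := fun l => by
    refine (Polynomial.natDegree_prod_le _ _).trans ?_
    refine (Finset.sum_le_card_nsmul _ _ K fun l' _ =>
      (natDegree_prod_C_sub_X_le _ _).trans (by simp)).trans ?_
    rw [Finset.card_erase_of_mem (Finset.mem_univ l), Finset.card_univ, Fintype.card_fin,
      smul_eq_mul, mul_comm]
  set P : Polynomial F := ∑ l, E l * H l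
  have hPdeg : P.degree < T.card := by
    rw [hT, ncsaThreshold_eq hℓ hK]
    refine lt_of_le_of_lt Polynomial.degree_le_natDegree ?_
    rw [Nat.cast_lt, Nat.lt_succ_iff]
    exact Polynomial.natDegree_sum_le_of_forall_le _ _ fun l _ =>
      Polynomial.natDegree_mul_le.trans (add_le_add (hE l) (hH l))
  have hint : (Lagrange.interpolate T α fun s =>
      (if h : s ∈ T then y ⟨s, h⟩ j else 0) * ∏ l, csaDelta f α l s) = P := by
    refine (Lagrange.eq_interpolate_of_eval_eq _ h.injective.injOn hPdeg fun s hs => ?_).symm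
    rw [dif_pos hs, hy ⟨s, hs⟩, Finset.sum_mul, Polynomial.eval_finsetSum]
    refine Finset.sum_congr rfl fun l _ => ?_
    rw [← Finset.mul_prod_erase univ _ (Finset.mem_univ l), Polynomial.eval_mul]
    have hne := h.csaDelta_ne_zero l s
    have hEs : (E l).eval (α s) = ∏ l' ∈ univ.erase l, csaDelta f α l' s := by
      simp [E, Polynomial.eval_prod, csaDelta]
    rw [hEs]
    field_simp
  -- The other groups drop out, since their `E l'` contains the factor f_{l,k} - X.
  have hP : P.eval (f l k) =
      (∏ l' ∈ univ.erase l, ∏ k', (f l' k' - f l k)) * (H l).eval (f l k) := by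
    rw [Polynomial.eval_finsetSum, Finset.sum_eq_single l]
    · simp [E, Polynomial.eval_prod]
    · intro l' _ hl'
      rw [Polynomial.eval_mul, Polynomial.eval_prod,
        Finset.prod_eq_zero (Finset.mem_erase.mpr ⟨hl'.symm, Finset.mem_univ _⟩), zero_mul]
      rw [Polynomial.eval_prod]
      exact Finset.prod_eq_zero (Finset.mem_univ k) (by simp)
    · simp
  have h1 := h.csaNorm_ne_zero l k
  have h2 := h.prod_erase_ne_zero l k
  simp only [csaDecoder, hint, Equiv.symm_apply_apply, csaScale, hP]
  field_simp

/-- The value of a multilinear map at the shares is a polynomial in the point of the server. -/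
theorem exists_polynomial_multilinear (f : Fin ℓ → Fin K → F) {N w : ℕ} {v : Fin N → ℕ}
    (Ω : MultilinearMap F (fun n : Fin N => Fin (v n) → F) (Fin w → F)) (l : Fin ℓ)
    (x : ∀ n, Fin K → Fin (v n) → F) (j : Fin w) :
    ∃ H : Polynomial F, H.natDegree ≤ N * (K - 1) ∧ ∀ z,
      H.eval z = Ω (fun n i => (sharePoly f l fun k => x n k i).eval z) j := by
  -- Multilinear expansion: one summand for each choice of a batch index per source.
  refine ⟨∑ κ : Fin N → Fin K, Polynomial.C (Ω (fun n => x n (κ n)) j) *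
    ∏ n, shareBasis f l (κ n), ?_, fun z => ?_⟩
  · refine Polynomial.natDegree_sum_le_of_forall_le _ _ fun κ _ =>
      (Polynomial.natDegree_C_mul_le _ _).trans ((Polynomial.natDegree_prod_le _ _).trans ?_)
    refine (Finset.sum_le_card_nsmul _ _ (K - 1) fun n _ => natDegree_shareBasis_le f l _).trans ?_
    simp
  · have : (fun n i => (sharePoly f l fun k => x n k i).eval z) =
        fun n => ∑ k, (shareBasis f l k).eval z • x n k := by
      funext n i
      simp [sharePoly, Polynomial.eval_finsetSum, mul_comm]
    rw [this, MultilinearMap.map_sum, Finset.sum_apply, Polynomial.eval_finsetSum]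
    refine Finset.sum_congr rfl fun κ _ => ?_
    rw [MultilinearMap.map_smul_univ]
    simp [Polynomial.eval_prod, mul_comm]

theorem DistinctPoints.csaDecoder_csaAnswer {f : Fin ℓ → Fin K → F} {α : Fin S → F}
    (h : DistinctPoints f α) (hℓ : 1 ≤ ℓ) (hK : 1 ≤ K) {N w : ℕ} {v : Fin N → ℕ}
    (Ω : MultilinearMap F (fun n : Fin N => Fin (v n) → F) (Fin w → F))
    {T : Finset (Fin S)} (hT : T.card = ncsaThreshold N ℓ K)
    (x : ∀ n, Fin (ℓ * K) → Fin (v n) → F) (a : Fin (ℓ * K)) :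
    csaDecoder f α N w T (fun s => csaAnswer f α Ω s fun n => csaShare f α s (x n)) a =
      Ω fun n => x n a := by
  funext j
  obtain ⟨⟨l, k⟩, rfl⟩ := finProdFinEquiv.surjective a
  choose H hH1 hH2 using fun l => exists_polynomial_multilinear f Ω l
    (fun n k => x n (finProdFinEquiv (l, k))) j
  refine (h.csaDecoder_eq hℓ hK hT H hH1 _ j (fun s => ?_) l k).trans ?_
  · simp only [csaAnswer, Finset.sum_apply, Pi.smul_apply, smul_eq_mul, hH2, h.csaShare_eq]
  · rw [hH2]
    have : (fun n i => (sharePoly f l fun k => x n (finProdFinEquiv (l, k)) i).eval (f l k)) =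
        fun n => csaNorm f l k • x n (finProdFinEquiv (l, k)) := by
      funext n i
      simp [eval_sharePoly_self]
    rw [this, MultilinearMap.map_smul_univ]
    have h1 := h.csaNorm_ne_zero l k
    simp only [Finset.prod_const, Finset.card_univ, Fintype.card_fin, Pi.smul_apply, smul_eq_mul]
    field_simp

theorem DistinctPoints.nCSACode_recoverable {f : Fin ℓ → Fin K → F} {α : Fin S → F}
    (h : DistinctPoints f α) (hℓ : 1 ≤ ℓ) (hK : 1 ≤ K) {N w : ℕ} {v : Fin N → ℕ}
    (Ω : MultilinearMap F (fun n : Fin N => Fin (v n) → F) (Fin w → F)) :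
    (nCSACode f α Ω (csaDecoder f α N w)).Recoverable Ω (ncsaThreshold N ℓ K) :=
  fun _ hT x => funext (h.csaDecoder_csaAnswer hℓ hK Ω hT x)

/-- The homogenization of degree `N` of a polynomial. -/
theorem sum_homogenized_eq {σ : Type*} (φ : MvPolynomial σ F) {N : ℕ} (hφ : φ.totalDegree ≤ N)
    (c : F) (x : σ → F) :
    ∑ e ∈ φ.support, φ.coeff e * ((∏ p ∈ e.support, (c * x p) ^ e p) * c ^ (N - e.degree)) =
      c ^ N * MvPolynomial.eval x φ := by
  rw [MvPolynomial.eval_eq, Finset.mul_sum]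
  refine Finset.sum_congr rfl fun e he => ?_
  have hdeg : e.degree ≤ N := (MvPolynomial.le_totalDegree he).trans hφ
  simp only [mul_pow, Finset.prod_mul_distrib, Finset.prod_pow_eq_pow_sum]
  have : c ^ N = c ^ (∑ p ∈ e.support, e p) * c ^ (N - e.degree) := by
    rw [← pow_add]
    congr 1
    have : e.degree = ∑ p ∈ e.support, e p := rfl
    omega
  rw [this]
  ring

/-- Padding with the coded constant gives every monomial exactly N share polynomials as factors,
hence one common degree bound. -/
theorem exists_polynomial_mvPolynomial (f : Fin ℓ → Fin K → F) {σ : Type*}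
    (φ : MvPolynomial σ F) {N : ℕ} (hφ : φ.totalDegree ≤ N) (l : Fin ℓ) (U : Fin K → F)
    (x : σ → Fin K → F) :
    ∃ H : Polynomial F, H.natDegree ≤ N * (K - 1) ∧ ∀ z,
      H.eval z = ∑ e ∈ φ.support, φ.coeff e *
        ((∏ p ∈ e.support, (sharePoly f l (x p)).eval z ^ e p) *
          (sharePoly f l U).eval z ^ (N - e.degree)) := by
  refine ⟨∑ e ∈ φ.support, Polynomial.C (φ.coeff e) *
    ((∏ p ∈ e.support, sharePoly f l (x p) ^ e p) * sharePoly f l U ^ (N - e.degree)), ?_, ?_⟩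
  · refine Polynomial.natDegree_sum_le_of_forall_le _ _ fun e he =>
      (Polynomial.natDegree_C_mul_le _ _).trans (Polynomial.natDegree_mul_le.trans ?_)
    have hdeg : e.degree ≤ N := (MvPolynomial.le_totalDegree he).trans hφ
    calc _ ≤ (∑ p ∈ e.support, e p * (K - 1)) + (N - e.degree) * (K - 1) := by
          refine add_le_add ((Polynomial.natDegree_prod_le _ _).trans
            (Finset.sum_le_sum fun p _ => ?_)) ?_
          · exact Polynomial.natDegree_pow_le_of_le _ (natDegree_sharePoly_le _ _ _)
          · exact Polynomial.natDegree_pow_le_of_le _ (natDegree_sharePoly_le _ _ _)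
      _ = N * (K - 1) := by
          rw [← Finset.sum_mul, ← add_mul]
          congr 1
          have : e.degree = ∑ p ∈ e.support, e p := rfl
          omega
  · intro z
    simp [Polynomial.eval_finsetSum, Polynomial.eval_prod]

/-- Decoding the answers for polynomials, when data and constant are rescaled by `u`. -/
theorem DistinctPoints.csaDecoder_csaPolyAnswer {f : Fin ℓ → Fin K → F} {α : Fin S → F}
    (h : DistinctPoints f α) (hℓ : 1 ≤ ℓ) (hK : 1 ≤ K) {N M w : ℕ} {v : Fin M → ℕ}
    {Φ : Fin w → MvPolynomial (Σ m : Fin M, Fin (v m)) F} (hΦ : ∀ j, (Φ j).totalDegree ≤ N)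
    {T : Finset (Fin S)} (hT : T.card = ncsaThreshold N ℓ K) (u : Fin (ℓ * K) → F)
    (x : ∀ m, Fin (ℓ * K) → Fin (v m) → F) (a : Fin (ℓ * K)) :
    csaDecoder f α N w T (fun s => csaPolyAnswer f α N Φ s (csaShare f α s fun a _ => u a)
      fun m => csaShare f α s fun a => u a • x m a) a =
      u a ^ N • polyMap Φ fun m => x m a := by
  funext j
  obtain ⟨⟨l, k⟩, rfl⟩ := finProdFinEquiv.surjective a
  choose H hH1 hH2 using fun l => exists_polynomial_mvPolynomial f (Φ j) (hΦ j) l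
    (fun k => u (finProdFinEquiv (l, k)))
    (fun p k => u (finProdFinEquiv (l, k)) * x p.1 (finProdFinEquiv (l, k)) p.2)
  refine (h.csaDecoder_eq hℓ hK hT H hH1 _ j (fun s => ?_) l k).trans ?_
  · simp only [csaPolyAnswer, hH2, h.csaShare_eq, Finset.mul_sum, Pi.smul_apply, smul_eq_mul]
    rw [Finset.sum_comm]
    refine Finset.sum_congr rfl fun l _ => Finset.sum_congr rfl fun e _ => ?_
    ring
  · rw [hH2]
    simp only [eval_sharePoly_self, ← mul_assoc]
    have h1 := h.csaNorm_ne_zero l k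
    have h2 := sum_homogenized_eq (Φ j) (hΦ j) (csaNorm f l k * u (finProdFinEquiv (l, k)))
      fun p => x p.1 (finProdFinEquiv (l, k)) p.2
    simp only [← mul_assoc] at h2
    rw [h2, Pi.smul_apply, polyMap, smul_eq_mul, mul_pow]
    field_simp

theorem DistinctPoints.nCSAPolyCode_recoverable {f : Fin ℓ → Fin K → F} {α : Fin S → F}
    (h : DistinctPoints f α) (hℓ : 1 ≤ ℓ) (hK : 1 ≤ K) {N M w : ℕ} {v : Fin M → ℕ}
    {Φ : Fin w → MvPolynomial (Σ m : Fin M, Fin (v m)) F} (hΦ : ∀ j, (Φ j).totalDegree ≤ N) :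
    (nCSAPolyCode f α N Φ (csaDecoder f α N w)).Recoverable (polyMap Φ)
      (ncsaThreshold N ℓ K) := by
  intro T hT x
  funext a
  have := h.csaDecoder_csaPolyAnswer hℓ hK hΦ hT (fun _ => 1) x a
  simp only [one_smul, one_pow] at this
  exact this

end Recovery

/-! ### Costs of N-CSA codes -/

section Costs

universe u

variable {F : Type u} [Field F] {S ℓ K : ℕ}

theorem one_le_logFactor (b : ℕ) : 1 ≤ logFactor b := by
  have := Real.log_natCast_nonneg b
  unfold logFactor
  linarith

/-- Rounding up to a power of two at most doubles the size; passing to the natural logarithm costs a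
factor 2 because log 2 > 1/2. -/
theorem clog_two_le {b : ℕ} (hb : 1 ≤ b) :
    2 ^ Nat.clog 2 b ≤ 2 * b ∧ (Nat.clog 2 b + 1 : ℝ) ≤ 2 * logFactor b := by
  rcases Nat.lt_or_ge 1 b with h | h
  · have h1 := Nat.pow_pred_clog_lt_self (b := 2) (by norm_num) h
    have h2 : 0 < Nat.clog 2 b := Nat.clog_pos (by norm_num) h
    obtain ⟨e, he⟩ := Nat.exists_eq_add_of_lt h2
    rw [zero_add] at he
    rw [he] at h1 ⊢
    simp only [Nat.pred_eq_sub_one, Nat.add_sub_cancel] at h1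
    refine ⟨by rw [pow_succ]; omega, ?_⟩
    have h3 : (e : ℝ) * Real.log 2 ≤ Real.log b := by
      rw [← Real.log_pow]
      exact Real.log_le_log (by positivity) (by exact_mod_cast h1.le)
    have h4 := Real.log_two_gt_d9
    have h5 : (e : ℝ) * (1 / 2) ≤ e * Real.log 2 := by gcongr; linarith
    unfold logFactor
    push_cast
    linarith
  · obtain rfl : b = 1 := le_antisymm h hb
    simp [logFactor]

/-- Products with diagonally scaled Cauchy matrices of size at most `B` take quasilinear time. -/
theorem exists_cauchyOps {B : ℕ} (hB : 1 ≤ B) (hF : ((B + 1 : ℕ) : ℕ∞) ≤ ENat.card F)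
    {ι κ : Type} [Fintype ι] [Fintype κ] (a : ι → F) (b : κ → F) (hb : Function.Injective b)
    (hab : ∀ i j, a i ≠ b j) (hι : Fintype.card ι ≤ B) (hκ : Fintype.card κ ≤ B)
    (d : κ → F) (d' : ι → F) :
    ∃ t, MatOps (Matrix.of fun j i => d j * (a i - b j)⁻¹ * d' i) t ∧
      (t : ℝ) ≤ 200000 * (B * logFactor B ^ 6) := by
  obtain ⟨g, hg, hinj⟩ := exists_injOn_pow B hF
  obtain ⟨h1, h2⟩ := clog_two_le hB
  have h3 : B ≤ 2 ^ Nat.clog 2 B := Nat.le_pow_clog (by norm_num) B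
  refine ⟨_, cauchyOps (Nat.clog 2 B) (fun e' he' h => hankelOps hg hinj e' (fun h8 => ?_) h) a b hb
    hab (hι.trans h3) (hκ.trans h3) d d', ?_⟩
  · have : 2 ^ e' ≤ 2 * B := (Nat.pow_le_pow_right (by norm_num) he').trans h1
    obtain ⟨r, rfl⟩ := Nat.exists_eq_add_of_le' (show 2 ≤ e' by omega)
    rw [Nat.add_sub_cancel]
    rw [pow_add] at this
    omega
  · have h1' : (2 : ℝ) ^ Nat.clog 2 B ≤ 2 * B := by exact_mod_cast h1
    have h4 := one_le_logFactor B
    push_cast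
    -- The constant is 1290 * 2 * 2^6 = 165120, rounded up to 200000.
    calc 1290 * (2 : ℝ) ^ Nat.clog 2 B * ((Nat.clog 2 B : ℝ) + 1) ^ 6
        ≤ 1290 * (2 * B) * (2 * logFactor B) ^ 6 := by gcongr
      _ = 165120 * (B * logFactor B ^ 6) := by ring
      _ ≤ _ := by gcongr; norm_num

/-- The shares of `d`-dimensional data are computed in quasilinear time. -/
theorem DistinctPoints.exists_csaShareOps {f : Fin ℓ → Fin K → F} {α : Fin S → F}
    (h : DistinctPoints f α) (hS : 1 ≤ S) (hℓ : 1 ≤ ℓ) (hK : 1 ≤ K) (hKS : K ≤ S)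
    (hF : ((S + 1 : ℕ) : ℕ∞) ≤ ENat.card F) (d : ℕ) :
    ∃ t, ComputableWithOps t (fun (x : Fin (ℓ * K) × Fin d → F)
        (q : Σ _ : Fin S, Fin ℓ × Fin d) => csaShare f α q.1 (fun l i => x (l, i)) q.2) ∧
      (t : ℝ) / (ℓ * K) ≤ 200000 * (d * S * logFactor S ^ 2 / K) * logFactor S ^ 4 := by
  -- In each group and each coordinate, encoding is one S × K Cauchy product with rows scaled by Δ.
  choose t ht1 ht2 using fun l => exists_cauchyOps hS hF (f l) α h.injective (fun k s => h.ne l k s)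
    (by simpa using hKS) (by simp) (fun s => csaDelta f α l s) (fun _ => 1)
  refine ⟨∑ p : Fin ℓ × Fin d, t p.1, ?_, ?_⟩
  · rw [computableWithOps_iff]
    have := Derives.iUnion (fun p : Fin ℓ × Fin d => t p.1) _ fun p =>
      (ht1 p.1).derives (inputsAndConstants F (Fin (ℓ * K) × Fin d)) constant_mem
        (fun k x => x (finProdFinEquiv (p.1, k), p.2)) fun k => input_mem _
    refine this.mono subset_rfl ?_
    rintro _ ⟨⟨s, p⟩, rfl⟩
    refine Set.mem_iUnion.mpr ⟨p, s, ?_⟩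
    funext x
    simp [csaShare, Finset.mul_sum, mul_assoc]
  · have h1 : (∑ p : Fin ℓ × Fin d, (t p.1 : ℝ)) ≤
        ℓ * d * (200000 * (S * logFactor S ^ 6)) := by
      refine (Finset.sum_le_card_nsmul _ _ _ fun p _ => ht2 p.1).trans (le_of_eq ?_)
      simp
    have h2 : (0 : ℝ) < ℓ := by exact_mod_cast hℓ
    have h3 : (0 : ℝ) < K := by exact_mod_cast hK
    push_cast
    calc _ ≤ ℓ * d * (200000 * (S * logFactor S ^ 6)) / (ℓ * K) := by gcongr
      _ = _ := by field_simp

/-- This bounds both dimensions of the decoding matrix by R. -/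
theorem mul_le_ncsaThreshold {N ℓ K : ℕ} (hN : 1 ≤ N) (hℓ : 1 ≤ ℓ) (hK : 1 ≤ K) :
    ℓ * K ≤ ncsaThreshold N ℓ K := by
  rw [ncsaThreshold_eq hℓ hK]
  obtain ⟨l, rfl⟩ := Nat.exists_eq_add_of_le' hℓ
  obtain ⟨k, rfl⟩ := Nat.exists_eq_add_of_le' hK
  simp only [Nat.add_sub_cancel]
  have : k ≤ N * k := Nat.le_mul_of_pos_left k hN
  nlinarith

/-- The decoders are computed in quasilinear time. -/
theorem DistinctPoints.exists_csaDecoderOps {f : Fin ℓ → Fin K → F} {α : Fin S → F}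
    (h : DistinctPoints f α) (hℓ : 1 ≤ ℓ) (hK : 1 ≤ K) {N : ℕ} (hN : 1 ≤ N)
    (hR : ncsaThreshold N ℓ K ≤ S) (hF : ((S + 1 : ℕ) : ℕ∞) ≤ ENat.card F) (w : ℕ)
    (T : Finset (Fin S)) (hT : T.card = ncsaThreshold N ℓ K) :
    ∃ t, ComputableWithOps t (fun (y : (Σ _ : T, Fin w) → F) (q : Fin (ℓ * K) × Fin w) =>
        csaDecoder f α N w T (fun s i => y ⟨s, i⟩) q.1 q.2) ∧
      (t : ℝ) / (ℓ * K) ≤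
        200000 * ((ℓ + N - 1) / ℓ * w * logFactor (ncsaThreshold N ℓ K) ^ 2) *
          logFactor (ncsaThreshold N ℓ K) ^ 4 := by
  have hR1 : 1 ≤ ncsaThreshold N ℓ K := by simp [ncsaThreshold]
  have hLR := mul_le_ncsaThreshold hN hℓ hK
  have hRK : ncsaThreshold N ℓ K ≤ K * (ℓ + N - 1) := by
    unfold ncsaThreshold
    have h1 : N ≤ K * (N + ℓ - 1) :=
      (show N ≤ N + ℓ - 1 by omega).trans (Nat.le_mul_of_pos_left _ hK)
    rw [show ℓ + N - 1 = N + ℓ - 1 by omega]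
    omega
  generalize ncsaThreshold N ℓ K = R at *
  have hF' : ((R + 1 : ℕ) : ℕ∞) ≤ ENat.card F :=
    le_trans (by exact_mod_cast Nat.succ_le_succ hR) hF
  -- The points f_{l,k} are not interpolation nodes, so the barycentric formula makes decoding a
  -- scaled Cauchy product. The minus sign comes from the entries (α_s - f_{l,k})⁻¹.
  obtain ⟨t, ht1, ht2⟩ := exists_cauchyOps hR1 hF' (fun s : T => α s)
    (fun a : Fin (ℓ * K) => f (finProdFinEquiv.symm a).1 (finProdFinEquiv.symm a).2)
    (fun a b hab => finProdFinEquiv.symm.injective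
      (Prod.ext (h.injective_left hab).1 (h.injective_left hab).2))
    (fun s a => (h.ne _ _ s).symm) (by simp [hT]) (by simpa using hLR)
    (fun a => (csaScale f N (finProdFinEquiv.symm a).1 (finProdFinEquiv.symm a).2)⁻¹ *
      -(Lagrange.nodal T α).eval (f (finProdFinEquiv.symm a).1 (finProdFinEquiv.symm a).2))
    (fun s : T => Lagrange.nodalWeight T α s * ∏ l, csaDelta f α l s)
  refine ⟨w * t, ?_, ?_⟩
  · rw [computableWithOps_iff]
    have := Derives.iUnion (fun _ : Fin w => t) _ fun j =>
      ht1.derives (inputsAndConstants F (Σ _ : T, Fin w)) constant_mem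
        (fun s y => y ⟨s, j⟩) fun s => input_mem _
    simp only [Finset.sum_const, Finset.card_univ, Fintype.card_fin, smul_eq_mul] at this
    refine this.mono subset_rfl ?_
    rintro _ ⟨⟨a, j⟩, rfl⟩
    refine Set.mem_iUnion.mpr ⟨j, a, ?_⟩
    funext y
    have hz : ∀ s ∈ T, f (finProdFinEquiv.symm a).1 (finProdFinEquiv.symm a).2 ≠ α s :=
      fun s _ => h.ne _ _ s
    simp only [csaDecoder]
    rw [Lagrange.eval_interpolate_not_at_node _ hz, ← Finset.sum_coe_sort T, Finset.mul_sum,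
      Finset.mul_sum]
    refine Finset.sum_congr rfl fun s _ => ?_
    simp only [Matrix.of_apply, dif_pos s.2, Subtype.coe_eta]
    rw [← neg_sub (α s), inv_neg]
    ring
  · have h2 : (0 : ℝ) < ℓ := by exact_mod_cast hℓ
    have h3 : (0 : ℝ) < K := by exact_mod_cast hK
    have h4 : (R : ℝ) ≤ K * (ℓ + N - 1) := by
      have : ((K * (ℓ + N - 1) : ℕ) : ℝ) = K * (ℓ + N - 1) := by
        rw [Nat.cast_mul, Nat.cast_sub (by omega)]
        push_cast
        ring
      rw [← this]
      exact_mod_cast hRK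
    have h5 := one_le_logFactor R
    push_cast
    calc (w : ℝ) * t / (ℓ * K) ≤ w * (200000 * (R * logFactor R ^ 6)) / (ℓ * K) := by gcongr
      _ ≤ w * (200000 * (K * (ℓ + N - 1) * logFactor R ^ 6)) / (ℓ * K) := by gcongr
      _ = _ := by field_simp

theorem uploadCost_eq {d : ℕ} (hℓ : 1 ≤ ℓ) (hd : 0 < d) :
    (∑ _ : Fin S, ((Fintype.card (Fin ℓ × Fin d) : ℕ) : ℚ≥0)) / ((ℓ * K : ℕ) * d) = S / K := by
  have h1 : (ℓ : ℚ≥0) ≠ 0 := by exact_mod_cast (by omega : ℓ ≠ 0)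
  have h2 : (d : ℚ≥0) ≠ 0 := by exact_mod_cast hd.ne'
  simp only [Finset.sum_const, Finset.card_univ, Fintype.card_fin, Fintype.card_prod,
    nsmul_eq_mul, Nat.cast_mul]
  rw [show (ℓ : ℚ≥0) * K * d = ℓ * d * K by ring, show (S : ℚ≥0) * (ℓ * d) = ℓ * d * S by ring]
  exact mul_div_mul_left _ _ (mul_ne_zero h1 h2)

theorem downloadCost_eq {R w : ℕ} (hR : R ≤ S) (hw : 0 < w) :
    (((univ : Finset (Fin S)).powersetCard R).sup fun T =>
      (∑ _ ∈ T, ((Fintype.card (Fin w) : ℕ) : ℚ≥0)) / ((ℓ * K : ℕ) * w)) = (R : ℚ≥0) / (ℓ * K) := by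
  have h2 : (w : ℚ≥0) ≠ 0 := by exact_mod_cast hw.ne'
  have hne : ((univ : Finset (Fin S)).powersetCard R).Nonempty :=
    Finset.powersetCard_nonempty.mpr (by simpa using hR)
  rw [Finset.sup_congr (g := fun _ => (R : ℚ≥0) / (ℓ * K)) rfl, Finset.sup_const hne]
  intro T hT
  simp only [Finset.sum_const, (Finset.mem_powersetCard.mp hT).2, Fintype.card_fin,
    nsmul_eq_mul, Nat.cast_mul]
  exact mul_div_mul_right _ _ h2

theorem Derives.mono_of_subset_union {ι : Type*} {A B B' : Set ((ι → F) → F)} {t : ℕ}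
    (h : B' ⊆ A ∪ B) (H : Derives A t B) : Derives A t B' := by
  obtain ⟨g, h1, h2⟩ := H
  exact ⟨g, h1, h.trans (Set.union_subset Set.subset_union_left h2)⟩

/-! ### Operation counts for the servers -/

section Server

variable {N w : ℕ} {v : Fin N → ℕ}
  (Ω : MultilinearMap F (fun n : Fin N => Fin (v n) → F) (Fin w → F)) {ω : ℕ}

/-- The computation of the summands of the answer of a server. -/
theorem derives_groups (H : ComputableWithOps ω
      (fun (x : (Σ n : Fin N, Fin (v n)) → F) => Ω fun n i => x ⟨n, i⟩)) :
    Derives (inputsAndConstants F (Σ n : Fin N, Fin ℓ × Fin (v n))) (ℓ * ω)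
      (⋃ l, Set.range fun j X => Ω (fun n i => X ⟨n, (l, i)⟩) j) := by
  have := Derives.iUnion (fun _ : Fin ℓ => ω) _ fun l => Derives.substitute H
    (A := inputsAndConstants F (Σ n : Fin N, Fin ℓ × Fin (v n))) constant_mem
    (fun p X => X ⟨p.1, (l, p.2)⟩) fun p => input_mem _
  simpa using this

theorem csaAnswer_apply (f : Fin ℓ → Fin K → F) (α : Fin S → F) (s : Fin S)
    (X : ∀ n, Fin ℓ × Fin (v n) → F) (j : Fin w) :
    csaAnswer f α Ω s X j = ∑ l, (csaDelta f α l s)⁻¹ * Ω (fun n i => X n (l, i)) j := by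
  simp [csaAnswer]

theorem derives_combination (c : Fin ℓ → F) (j : Fin w) :
    Derives (inputsAndConstants F (Σ n : Fin N, Fin ℓ × Fin (v n)) ∪
      ⋃ l, Set.range fun j X => Ω (fun n i => X ⟨n, (l, i)⟩) j) (ℓ * 2)
      {fun X => ∑ l, c l * Ω (fun n i => X ⟨n, (l, i)⟩) j} := by
  have := Derives.sum_mul (A := inputsAndConstants F (Σ n : Fin N, Fin ℓ × Fin (v n)) ∪
      ⋃ l, Set.range fun j X => Ω (fun n i => X ⟨n, (l, i)⟩) j) univ c
    (fun l X => Ω (fun n i => X ⟨n, (l, i)⟩) j) (fun a => Or.inl (constant_mem a))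
    (fun l _ => Or.inr (Set.mem_iUnion.mpr ⟨l, j, rfl⟩))
  simpa using this

theorem csaAnswerOps (f : Fin ℓ → Fin K → F) (α : Fin S → F) (s : Fin S)
    (H : ComputableWithOps ω
      (fun (x : (Σ n : Fin N, Fin (v n)) → F) => Ω fun n i => x ⟨n, i⟩)) :
    ComputableWithOps (ℓ * ω + w * (ℓ * 2))
      (fun (X : (Σ n : Fin N, Fin ℓ × Fin (v n)) → F) => csaAnswer f α Ω s fun n i => X ⟨n, i⟩) := by
  rw [computableWithOps_iff]
  refine (derives_groups Ω H).then ?_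
  have := Derives.range _ fun j => derives_combination Ω (fun l => (csaDelta f α l s)⁻¹) j
  rw [Fintype.card_fin] at this
  simpa only [csaAnswer_apply] using this

/-- A component of a multilinear map in at least two arguments that is an input or a constant
vanishes. -/
theorem component_eq_zero_of_mem (hN : 2 ≤ N) (j : Fin w)
    (h : (fun (x : (Σ n : Fin N, Fin (v n)) → F) => Ω (fun n i => x ⟨n, i⟩) j) ∈
      inputsAndConstants F (Σ n : Fin N, Fin (v n))) :
    ∀ x, Ω x j = 0 := by
  rcases h with ⟨⟨n, i⟩, h⟩ | ⟨a, h⟩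
  · exfalso
    have : Nontrivial (Fin N) := Fin.nontrivial_iff_two_le.mpr hN
    obtain ⟨n', hn'⟩ := exists_ne n
    -- Data 1 for source n and 0 for all others: the input equals 1, but Ω vanishes.
    have h1 := congrFun h fun p => if p.1 = n then 1 else 0
    rw [Ω.map_coord_zero n' (by funext i; simp [hn'])] at h1
    simp at h1
  · have h0 := congrFun h fun _ => 0
    rw [Ω.map_coord_zero ⟨0, by omega⟩ rfl] at h0
    intro x
    have := congrFun h fun p => x p.1 p.2
    rw [← h0] at this
    exact this

/-- Equal components of Ω need only one combination. For N ≥ 2 each component is zero or one of the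
ω intermediate results, so at most ω combinations are needed. For N = 1 this fails: the identity map
takes no operations. -/
theorem csaAnswerOps_of_two_le (hN : 2 ≤ N) (f : Fin ℓ → Fin K → F) (α : Fin S → F) (s : Fin S)
    (H : ComputableWithOps ω
      (fun (x : (Σ n : Fin N, Fin (v n)) → F) => Ω fun n i => x ⟨n, i⟩)) :
    ComputableWithOps (ℓ * ω + ω * (ℓ * 2))
      (fun (X : (Σ n : Fin N, Fin ℓ × Fin (v n)) → F) => csaAnswer f α Ω s fun n i => X ⟨n, i⟩) := by
  classical
  rw [computableWithOps_iff]
  refine (derives_groups Ω H).then ?_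
  obtain ⟨g, -, hg⟩ := H
  set φ : Fin w → ((Σ n : Fin N, Fin (v n)) → F) → F := fun j x => Ω (fun n i => x ⟨n, i⟩) j
  set A := inputsAndConstants F (Σ n : Fin N, Fin ℓ × Fin (v n)) ∪
      ⋃ l, Set.range fun j X => Ω (fun n i => X ⟨n, (l, i)⟩) j
  set ψ : Fin w → ((Σ n : Fin N, Fin ℓ × Fin (v n)) → F) → F := fun j X =>
    ∑ l, (csaDelta f α l s)⁻¹ * Ω (fun n i => X ⟨n, (l, i)⟩) j
  have hψ : ∀ j j', φ j = φ j' → ψ j = ψ j' := fun j j' h => by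
    funext X
    exact Finset.sum_congr rfl fun l _ =>
      congrArg _ (congrFun h fun p => X ⟨p.1, (l, p.2)⟩)
  -- One combination for each step of the computation of Ω, not for each component; steps that are
  -- no component yield 0.
  have := Derives.range (A := A) (t := ℓ * 2)
    (fun i : Fin ω => if h : ∃ j, φ j = g i then ψ h.choose else fun _ => 0) fun i => by
      split_ifs with h
      · exact derives_combination Ω _ _
      · exact (Derives.of_subset (Set.singleton_subset_iff.mpr (Or.inl (constant_mem 0)))).le
          (Or.inl (constant_mem 0)) (Nat.zero_le _)
  rw [Fintype.card_fin] at this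
  refine this.mono_of_subset_union ?_
  rintro _ ⟨j, rfl⟩
  have hj := hg j
  rw [availableAfter_eq] at hj
  have hans : (fun X : (Σ n : Fin N, Fin ℓ × Fin (v n)) → F =>
      csaAnswer f α Ω s (fun n i => X ⟨n, i⟩) j) = ψ j := by
    funext X
    exact csaAnswer_apply Ω f α s _ j
  rcases hj with hj | ⟨i, hi, hj⟩
  · have h0 := component_eq_zero_of_mem Ω hN j hj
    refine Or.inl (Or.inl (Or.inr ⟨0, ?_⟩))
    beta_reduce
    rw [hans]
    funext X
    simp [ψ, h0]
  · refine Or.inr ⟨⟨i, hi⟩, ?_⟩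
    have hex : ∃ j, φ j = g i := ⟨j, hj⟩
    beta_reduce
    rw [dif_pos hex, hans]
    exact hψ _ _ (hex.choose_spec.trans hj.symm)

end Server

end Costs

/-! ### Optimality of the recovery threshold -/

section Optimality

universe u

variable {F : Type u} [Field F] {S ℓ K : ℕ}

/-- A polynomial of degree less than `K` is determined by its values at the points of a group. -/
theorem DistinctPoints.sharePoly_eq {f : Fin ℓ → Fin K → F} {α : Fin S → F}
    (h : DistinctPoints f α) (l : Fin ℓ) {P : Polynomial F} (hP : P.degree < K) {x : Fin K → F}
    (hx : ∀ k, csaNorm f l k * x k = P.eval (f l k)) : sharePoly f l x = P := by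
  refine Polynomial.eq_of_degrees_lt_of_eval_index_eq (univ : Finset (Fin K)) (v := f l)
    (fun a _ b _ hab => (h.injective_left hab).2) ?_ (by simpa using hP) fun k _ => ?_
  · rcases Nat.eq_zero_or_pos K with rfl | hK
    · simp [sharePoly]
    · rw [Finset.card_univ, Fintype.card_fin]
      refine lt_of_le_of_lt Polynomial.degree_le_natDegree (Nat.cast_lt.mpr ?_)
      have := natDegree_sharePoly_le f l x
      omega
  · rw [eval_sharePoly_self, hx]

/-- Blocks are cut off greedily; they will be the servers blinded by one source each. -/
theorem exists_cover {γ : Type*} [DecidableEq γ] (a b m : ℕ) (T : Finset γ)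
    (hT : T.card ≤ a + m * b) :
    ∃ (P : Fin m → Finset γ) (T₀ : Finset γ), (∀ i, (P i).card ≤ b) ∧ T₀.card ≤ a ∧
      ∀ s ∈ T, s ∈ T₀ ∨ ∃ i, s ∈ P i := by
  induction m generalizing T with
  | zero => exact ⟨Fin.elim0, T, fun i => i.elim0, by simpa using hT, fun s hs => Or.inl hs⟩
  | succ m ih =>
    obtain ⟨U, hU, hUc⟩ := Finset.exists_subset_card_eq (Nat.min_le_right b T.card)
    obtain ⟨P, T₀, h1, h2, h3⟩ := ih (T \ U) (by
      rw [Finset.card_sdiff_of_subset hU, hUc]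
      rw [Nat.succ_mul] at hT
      omega)
    refine ⟨Fin.cons U P, T₀, fun i => ?_, h2, fun s hs => ?_⟩
    · refine Fin.cases ?_ (fun i => ?_) i
      · rw [Fin.cons_zero, hUc]
        exact Nat.min_le_left _ _
      · rw [Fin.cons_succ]
        exact h1 i
    · by_cases hsU : s ∈ U
      · exact Or.inr ⟨0, by simpa using hsU⟩
      · rcases h3 s (Finset.mem_sdiff.mpr ⟨hs, hsU⟩) with h | ⟨i, hi⟩
        · exact Or.inl h
        · exact Or.inr ⟨i.succ, by simpa using hi⟩

/-- The product of `N` scalars. -/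
def productMap (F : Type u) [Field F] (N : ℕ) :
    MultilinearMap F (fun _ : Fin N => Fin 1 → F) (Fin 1 → F) :=
  (LinearMap.pi fun _ => LinearMap.id).compMultilinearMap
    ((MultilinearMap.mkPiAlgebra F (Fin N) F).compLinearMap fun _ => LinearMap.proj 0)

theorem productMap_apply (N : ℕ) (x : Fin N → Fin 1 → F) (j : Fin 1) :
    productMap F N x j = ∏ n, x n 0 := by
  simp [productMap]

/-- Nonzero data whose shares vanish for up to `K - 1` given servers. -/
theorem DistinctPoints.exists_csaShare_eq_zero {f : Fin ℓ → Fin K → F} {α : Fin S → F}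
    (h : DistinctPoints f α) (hK : 1 ≤ K) {P : Finset (Fin S)} (hP : P.card ≤ K - 1) :
    ∃ y : Fin (ℓ * K) → F, (∀ a, y a ≠ 0) ∧
      ∀ s ∈ P, ∀ l, csaShare f α s (fun a (_ : Fin 1) => y a) (l, 0) = 0 := by
  -- In every group the share polynomial is made equal to the nodal polynomial of `P`, which has
  -- degree less than K and no zero among the points f_{l,k}.
  refine ⟨fun a => (Lagrange.nodal P α).eval (f (finProdFinEquiv.symm a).1
    (finProdFinEquiv.symm a).2) / csaNorm f (finProdFinEquiv.symm a).1 (finProdFinEquiv.symm a).2,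
    fun a => div_ne_zero ?_ (h.csaNorm_ne_zero _ _), fun s hs l => ?_⟩
  · rw [Lagrange.eval_nodal, Finset.prod_ne_zero_iff]
    exact fun s _ => sub_ne_zero.mpr (h.ne _ _ s)
  · rw [h.csaShare_eq, h.sharePoly_eq l (P := Lagrange.nodal P α)]
    · exact Lagrange.eval_nodal_at_node hs
    · rw [Lagrange.degree_nodal, Nat.cast_lt]
      omega
    · intro k
      beta_reduce
      rw [Equiv.symm_apply_apply]
      exact mul_div_cancel₀ _ (h.csaNorm_ne_zero l k)

/-- Fewer servers than the threshold are not enough for the product of `N` scalars. -/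
theorem DistinctPoints.not_recoverable {f : Fin ℓ → Fin K → F} {α : Fin S → F}
    (h : DistinctPoints f α) (hℓ : 1 ≤ ℓ) (hK : 1 ≤ K) {N : ℕ} (hN : 1 ≤ N)
    (hR : ncsaThreshold N ℓ K ≤ S) {r : ℕ} (hr : r < ncsaThreshold N ℓ K)
    (dec : DecoderFamily F S (ℓ * K) 1) :
    ¬ (nCSACode f α (productMap F N) dec).Recoverable (productMap F N) r := by
  intro hrec
  obtain ⟨n, rfl⟩ := Nat.exists_eq_add_of_le' hN
  obtain ⟨T, -, hTc⟩ := Finset.exists_subset_card_eq (s := (univ : Finset (Fin S))) (n := r)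
    (by rw [Finset.card_univ, Fintype.card_fin]; omega)
  -- This uses r ≤ R - 1 = (L - 1) + (N - 1)(K - 1), with N = n + 1.
  obtain ⟨P, T₀, hP, hT₀, hcover⟩ := exists_cover (ℓ * K - 1) (K - 1) n T (by
    rw [ncsaThreshold_eq hℓ hK] at hr
    obtain ⟨l, rfl⟩ := Nat.exists_eq_add_of_le' hℓ
    obtain ⟨k, rfl⟩ := Nat.exists_eq_add_of_le' hK
    simp only [Nat.add_sub_cancel] at hr ⊢
    have e1 : (l + 1) * (k + 1) = (k + 1) * l + k + 1 := by ring
    have e2 : (n + 1) * k = n * k + k := by ring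
    omega)
  choose y hy0 hy using fun i => h.exists_csaShare_eq_zero (ℓ := ℓ) hK (hP i)
  -- The answers on `T₀` as linear forms in the data of source 0, with the other sources fixed to
  -- `y`; the Δ of source 0 has cancelled.
  set A : Matrix T₀ (Fin (ℓ * K)) F := Matrix.of fun s a =>
    (∏ i, csaShare f α s (fun a (_ : Fin 1) => y i a) ((finProdFinEquiv.symm a).1, 0)) *
      (f (finProdFinEquiv.symm a).1 (finProdFinEquiv.symm a).2 - α s)⁻¹ with hA
  have hLpos : 0 < ℓ * K := Nat.mul_pos hℓ hK
  obtain ⟨X, hX, hX0⟩ := Submodule.exists_mem_ne_zero_of_ne_bot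
    (LinearMap.ker_ne_bot_of_finrank_lt (f := A.mulVecLin) (by
      rw [Module.finrank_fintype_fun_eq_card, Module.finrank_fintype_fun_eq_card,
        Fintype.card_coe, Fintype.card_fin]
      omega))
  obtain ⟨a, ha⟩ := Function.ne_iff.mp hX0
  set x : Fin (n + 1) → Fin (ℓ * K) → Fin 1 → F := fun m a _ =>
    (Fin.cons (X a) (fun i => y i a) : Fin (n + 1) → F) m with hx
  have hx0 : x 0 = fun a _ => X a := by simp [hx]
  have hxs : ∀ i : Fin n, x i.succ = fun a _ => y i a := fun i => by simp [hx]
  have hresp : ∀ s ∈ T, csaAnswer f α (productMap F (n + 1)) s (fun m => csaShare f α s (x m)) =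
      0 := by
    intro s hs
    funext j
    rw [csaAnswer_apply]
    simp only [productMap_apply, Fin.prod_univ_succ, hx0, hxs]
    rcases hcover s hs with hs0 | ⟨i, hi⟩
    · have hker := congrFun (LinearMap.mem_ker.mp hX) ⟨s, hs0⟩
      simp only [Matrix.mulVecLin_apply, Matrix.mulVec, dotProduct, hA, Matrix.of_apply,
        Pi.zero_apply] at hker
      rw [← finProdFinEquiv.sum_comp, Fintype.sum_prod_type] at hker
      simp only [Equiv.symm_apply_apply] at hker
      rw [Pi.zero_apply, ← hker]
      refine Finset.sum_congr rfl fun l _ => ?_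
      have hne := h.csaDelta_ne_zero l s
      rw [csaShare]
      simp only [mul_assoc, ← Finset.mul_sum]
      rw [inv_mul_cancel_left₀ hne, mul_comm]
    · refine Finset.sum_eq_zero fun l _ => ?_
      rw [Finset.prod_eq_zero (Finset.mem_univ i) (hy i s hi l), mul_zero, mul_zero]
  have hresp0 : ∀ s, csaAnswer f α (productMap F (n + 1)) s
      (fun m => csaShare f α s ((0 : Fin (n + 1) → Fin (ℓ * K) → Fin 1 → F) m)) = 0 := by
    intro s
    funext j
    rw [csaAnswer_apply]
    simp [productMap_apply, csaShare]
  have h1 := hrec T hTc x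
  have h2 := hrec T hTc 0
  -- The data `x` and 0 cannot be told apart on `T`, although the products differ at index `a`.
  have h3 : (fun s : T => (nCSACode f α (productMap F (n + 1)) dec).response x s) =
      fun s : T => (nCSACode f α (productMap F (n + 1)) dec).response 0 s :=
    funext fun s => (hresp s s.2).trans (hresp0 s).symm
  rw [h3, h2] at h1
  have h4 := congrFun (congrFun h1 a) 0
  rw [productMap_apply, productMap_apply] at h4
  simp only [Fin.prod_univ_succ, hx0, hxs] at h4
  rw [Pi.zero_apply, Pi.zero_apply, Pi.zero_apply, zero_mul] at h4
  exact mul_ne_zero ha (Finset.prod_ne_zero_iff.mpr fun i _ => hy0 i a) h4.symm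

end Optimality

/-! ### Lagrange coded computing -/

section Lagrange

universe u

variable {F : Type u} [Field F] {S K : ℕ}

theorem prod_fin_one_mul {M : Type*} [CommMonoid M] (g : Fin (1 * K) → M) :
    ∏ a, g a = ∏ k, g (finProdFinEquiv (0, k)) := by
  rw [← finProdFinEquiv.prod_comp, Fintype.prod_prod_type, Fin.prod_univ_one]

theorem sum_fin_one_mul {M : Type*} [AddCommMonoid M] (g : Fin (1 * K) → M) :
    ∑ a, g a = ∑ k, g (finProdFinEquiv (0, k)) := by
  rw [← finProdFinEquiv.sum_comp, Fintype.sum_prod_type, Fin.sum_univ_one]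

theorem prod_erase_fin_one_mul {M : Type*} [CommMonoid M] (g : Fin (1 * K) → M) (k : Fin K) :
    ∏ a ∈ univ.erase (finProdFinEquiv (0, k)), g a =
      ∏ k' ∈ univ.erase k, g (finProdFinEquiv (0, k')) := by
  rw [prod_univ_erase_eq_ite, prod_univ_erase_eq_ite, prod_fin_one_mul]
  simp

variable {f : Fin 1 → Fin K → F} {α : Fin S → F} {β : Fin (1 * K) → F}

theorem lccWeight_eq (hβ : ∀ l k, β (finProdFinEquiv (l, k)) = f l k) (k : Fin K) :
    lccWeight β (finProdFinEquiv (0, k)) = (csaNorm f 0 k)⁻¹ := by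
  rw [lccWeight, prod_erase_fin_one_mul]
  simp only [hβ, csaNorm]

theorem DistinctPoints.lccWeight_ne_zero (h : DistinctPoints f α)
    (hβ : ∀ l k, β (finProdFinEquiv (l, k)) = f l k) (a : Fin (1 * K)) : lccWeight β a ≠ 0 := by
  obtain ⟨⟨l, k⟩, rfl⟩ := finProdFinEquiv.surjective a
  obtain rfl := Subsingleton.elim l 0
  rw [lccWeight_eq hβ]
  exact inv_ne_zero (h.csaNorm_ne_zero 0 k)

/-- The Lagrange basis polynomials are the `shareBasis` polynomials divided by `csaNorm`; the signs
of numerator and denominator cancel factor by factor. -/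
theorem DistinctPoints.lccShare_eq (h : DistinctPoints f α)
    (hβ : ∀ l k, β (finProdFinEquiv (l, k)) = f l k) {d : ℕ} (x : Fin (1 * K) → Fin d → F)
    (s : Fin S) (l : Fin 1) (i : Fin d) :
    lccShare β α s x i = csaShare f α s (fun a => lccWeight β a • x a) (l, i) := by
  obtain rfl := Subsingleton.elim l 0
  rw [h.csaShare_eq]
  simp only [lccShare, sum_fin_one_mul, prod_erase_fin_one_mul, hβ, sharePoly, shareBasis,
    Polynomial.eval_finsetSum, Polynomial.eval_mul, Polynomial.eval_C, Polynomial.eval_prod,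
    Polynomial.eval_sub, Polynomial.eval_X, Pi.smul_apply, smul_eq_mul, lccWeight_eq hβ]
  refine Finset.sum_congr rfl fun k _ => ?_
  have : ∀ k', (α s - f 0 k') / (f 0 k - f 0 k') = (f 0 k' - α s) / (f 0 k' - f 0 k) := fun k' => by
    rw [← neg_div_neg_eq, neg_sub, neg_sub]
  simp only [this, Finset.prod_div_distrib, csaNorm]
  ring

/-- The constant 1 is interpolated by the polynomial 1, so the padding factors disappear from LCC
answers. -/
theorem DistinctPoints.csaShare_lccWeight (h : DistinctPoints f α) (hK : 1 ≤ K)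
    (hβ : ∀ l k, β (finProdFinEquiv (l, k)) = f l k) (s : Fin S) (l : Fin 1) :
    csaShare f α s (fun a (_ : Fin 1) => lccWeight β a) (l, 0) = 1 := by
  obtain rfl := Subsingleton.elim l 0
  rw [h.csaShare_eq, h.sharePoly_eq 0 (P := 1), Polynomial.eval_one]
  · rw [Polynomial.degree_one]
    exact_mod_cast hK
  · intro k
    rw [lccWeight_eq hβ, Polynomial.eval_one, mul_inv_cancel₀ (h.csaNorm_ne_zero 0 k)]

theorem DistinctPoints.map_lccShare_eq (h : DistinctPoints f α)
    (hβ : ∀ l k, β (finProdFinEquiv (l, k)) = f l k) {N w : ℕ} {v : Fin N → ℕ}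
    (Ω : MultilinearMap F (fun n : Fin N => Fin (v n) → F) (Fin w → F))
    (x : ∀ n, Fin (1 * K) → Fin (v n) → F) (s : Fin S) (l : Fin 1) :
    Ω (fun n => lccShare β α s (x n)) = csaDelta f α l s •
      csaAnswer f α Ω s fun n => csaShare f α s fun a => lccWeight β a • x n a := by
  obtain rfl := Subsingleton.elim l 0
  rw [csaAnswer, Fin.sum_univ_one, smul_inv_smul₀ (h.csaDelta_ne_zero 0 s)]
  congr 1
  funext n i
  exact h.lccShare_eq hβ (x n) s 0 i

theorem DistinctPoints.polyMap_lccShare_eq (h : DistinctPoints f α) (hK : 1 ≤ K)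
    (hβ : ∀ l k, β (finProdFinEquiv (l, k)) = f l k) (N : ℕ) {M w : ℕ} {v : Fin M → ℕ}
    (Φ : Fin w → MvPolynomial (Σ m : Fin M, Fin (v m)) F)
    (x : ∀ m, Fin (1 * K) → Fin (v m) → F) (s : Fin S) (l : Fin 1) :
    polyMap Φ (fun m => lccShare β α s (x m)) = csaDelta f α l s •
      csaPolyAnswer f α N Φ s (csaShare f α s fun a _ => lccWeight β a)
        fun m => csaShare f α s fun a => lccWeight β a • x m a := by
  obtain rfl := Subsingleton.elim l 0
  funext j
  have h1 := h.csaDelta_ne_zero 0 s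
  simp only [polyMap, csaPolyAnswer, Pi.smul_apply, smul_eq_mul, MvPolynomial.eval_eq,
    Fin.sum_univ_one, h.csaShare_lccWeight hK hβ, one_pow, mul_one, Finset.mul_sum]
  refine Finset.sum_congr rfl fun e _ => ?_
  rw [mul_left_comm, mul_inv_cancel_left₀ h1]
  congr 1
  refine Finset.prod_congr rfl fun p _ => ?_
  rw [h.lccShare_eq hβ (x p.1) s 0 p.2]

/-- The decoders of LCC codes. -/
def lccDecoder (f : Fin 1 → Fin K → F) (α : Fin S → F) (β : Fin (1 * K) → F) (N w : ℕ) :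
    DecoderFamily F S (1 * K) w := fun T y a =>
  -- Rescaling the data (and the coded constant) by the weight multiplies the decoded value by its
  -- N-th power.
  (lccWeight β a ^ N)⁻¹ •
    csaDecoder f α N w T (fun s => (csaDelta f α 0 s)⁻¹ • y s) a

theorem DistinctPoints.lccCode_recoverable (h : DistinctPoints f α) (hK : 1 ≤ K)
    (hβ : ∀ l k, β (finProdFinEquiv (l, k)) = f l k) {N w : ℕ} {v : Fin N → ℕ}
    (Ω : MultilinearMap F (fun n : Fin N => Fin (v n) → F) (Fin w → F)) :
    (lccCode β α Ω (lccDecoder f α β N w)).Recoverable Ω (ncsaThreshold N 1 K) := by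
  intro T hT x
  funext a
  have h1 := h.csaDecoder_csaAnswer le_rfl hK Ω hT (fun n a => lccWeight β a • x n a) a
  rw [MultilinearMap.map_smul_univ, Finset.prod_const, Finset.card_univ, Fintype.card_fin] at h1
  have h2 : (fun s : T => (csaDelta f α 0 s)⁻¹ • Ω fun n => lccShare β α s (x n)) =
      fun s : T => csaAnswer f α Ω s fun n => csaShare f α s fun a => lccWeight β a • x n a := by
    funext s
    rw [h.map_lccShare_eq hβ Ω x s 0, inv_smul_smul₀ (h.csaDelta_ne_zero 0 s)]
  change (lccWeight β a ^ N)⁻¹ • csaDecoder f α N w T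
    (fun s => (csaDelta f α 0 s)⁻¹ • Ω fun n => lccShare β α s (x n)) a = _
  rw [h2, h1, inv_smul_smul₀ (pow_ne_zero N (h.lccWeight_ne_zero hβ a))]

theorem DistinctPoints.lccCode_polyMap_recoverable (h : DistinctPoints f α) (hK : 1 ≤ K)
    (hβ : ∀ l k, β (finProdFinEquiv (l, k)) = f l k) {N M w : ℕ} {v : Fin M → ℕ}
    {Φ : Fin w → MvPolynomial (Σ m : Fin M, Fin (v m)) F} (hΦ : ∀ j, (Φ j).totalDegree ≤ N) :
    (lccCode β α (polyMap Φ) (lccDecoder f α β N w)).Recoverable (polyMap Φ)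
      (ncsaThreshold N 1 K) := by
  intro T hT x
  funext a
  have h1 := h.csaDecoder_csaPolyAnswer le_rfl hK hΦ hT (lccWeight β) x a
  have h2 : (fun s : T => (csaDelta f α 0 s)⁻¹ • polyMap Φ fun m => lccShare β α s (x m)) =
      fun s : T => csaPolyAnswer f α N Φ s (csaShare f α s fun a _ => lccWeight β a)
        fun m => csaShare f α s fun a => lccWeight β a • x m a := by
    funext s
    rw [h.polyMap_lccShare_eq hK hβ N Φ x s 0, inv_smul_smul₀ (h.csaDelta_ne_zero 0 s)]
  change (lccWeight β a ^ N)⁻¹ • csaDecoder f α N w T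
    (fun s => (csaDelta f α 0 s)⁻¹ • polyMap Φ fun m => lccShare β α s (x m)) a = _
  rw [h2, h1, inv_smul_smul₀ (pow_ne_zero N (h.lccWeight_ne_zero hβ a))]

end Lagrange

/-- Distinct points exist in every field that is large enough. -/
theorem exists_distinctPoints {F : Type*} [Field F] {S ℓ K : ℕ}
    (hF : ((ℓ * K + S : ℕ) : ℕ∞) ≤ ENat.card F) :
    ∃ (f : Fin ℓ → Fin K → F) (α : Fin S → F), DistinctPoints f α := by
  have hemb : Nonempty (Fin (ℓ * K + S) ↪ F) := by
    rcases finite_or_infinite F with hfin | hinf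
    · have := Fintype.ofFinite F
      rw [ENat.card_eq_coe_fintype_card, Nat.cast_le] at hF
      exact Function.Embedding.nonempty_of_card_le (by simpa using hF)
    · exact ⟨Fin.valEmbedding.trans (Infinite.natEmbedding F)⟩
  obtain ⟨e⟩ := hemb
  let E : (Fin ℓ × Fin K) ⊕ Fin S ≃ Fin (ℓ * K + S) :=
    (Equiv.sumCongr finProdFinEquiv (Equiv.refl _)).trans finSumFinEquiv
  refine ⟨fun l k => e (E (Sum.inl (l, k))), fun s => e (E (Sum.inr s)), ?_⟩
  have : Sum.elim (fun p : Fin ℓ × Fin K => e (E (Sum.inl (p.1, p.2))))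
      (fun s => e (E (Sum.inr s))) = e ∘ E := by
    funext p
    rcases p with p | s <;> rfl
  rw [DistinctPoints, this]
  exact e.injective.comp E.injective

end

/-! ### Assembly of the theorem -/

theorem theorem3 :
    ∃ C c : ℕ, ∀ (F : Type*) [Field F] (N S ℓ K : ℕ), 1 ≤ N → 1 ≤ ℓ → 1 ≤ K →
      ((ℓ * K + S : ℕ) : ℕ∞) ≤ ENat.card F → ncsaThreshold N ℓ K ≤ S →
      -- there are distinct points as the construction needs them, and any such points will do
      (∃ (f : Fin ℓ → Fin K → F) (α : Fin S → F), DistinctPoints f α) ∧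
      ∀ (f : Fin ℓ → Fin K → F) (α : Fin S → F), DistinctPoints f α →
        (∀ w : ℕ, ∃ dec : DecoderFamily F S (ℓ * K) w,
          -- batch evaluation of an `N`-linear map
          (∀ (v : Fin N → ℕ)
              (Ω : MultilinearMap F (fun n : Fin N => Fin (v n) → F) (Fin w → F)),
            -- recovery from any `R` servers
            (nCSACode f α Ω dec).Recoverable Ω (ncsaThreshold N ℓ K) ∧
            -- upload and download costs
            (∀ n, 0 < v n → (nCSACode f α Ω dec).uploadCost n = S / K) ∧
            (0 < w → (nCSACode f α Ω dec).downloadCost (ncsaThreshold N ℓ K) =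
              (ncsaThreshold N ℓ K : ℚ≥0) / (ℓ * K)) ∧
            -- server complexity
            (∀ ω : ℕ,
              ComputableWithOps ω
                (fun (x : (Σ n : Fin N, Fin (v n)) → F) => Ω fun n i => x ⟨n, i⟩) →
              ∀ s, (∃ t, ComputableWithOps t ((nCSACode f α Ω dec).ansFlat s) ∧
                  (t : ℝ) / (ℓ * K) ≤ C * ((ω + w) / K)) ∧
                (2 ≤ N → ∃ t, ComputableWithOps t ((nCSACode f α Ω dec).ansFlat s) ∧
                  (t : ℝ) / (ℓ * K) ≤ C * (ω / K))) ∧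
            -- encoding complexity
            (∀ n, ∃ t, ComputableWithOps t ((nCSACode f α Ω dec).encFlat n) ∧
              (t : ℝ) / (ℓ * K) ≤
                C * (v n * S * logFactor S ^ 2 / K) * logFactor S ^ c) ∧
            -- decoding complexity
            (∀ T : Finset (Fin S), T.card = ncsaThreshold N ℓ K →
              ∃ t, ComputableWithOps t ((nCSACode f α Ω dec).decFlat T) ∧
                (t : ℝ) / (ℓ * K) ≤
                  C * ((ℓ + N - 1) / ℓ * w * logFactor (ncsaThreshold N ℓ K) ^ 2) *
                    logFactor (ncsaThreshold N ℓ K) ^ c)) ∧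
          -- batch evaluation of multivariate polynomials of total degree at most `N`
          (∀ (M : ℕ) (v : Fin M → ℕ) (Φ : Fin w → MvPolynomial (Σ m : Fin M, Fin (v m)) F),
            (∀ j, (Φ j).totalDegree ≤ N) →
            (nCSAPolyCode f α N Φ dec).Recoverable (polyMap Φ) (ncsaThreshold N ℓ K) ∧
            (∀ m, 0 < v m → (nCSAPolyCode f α N Φ dec).uploadCost m = S / K) ∧
            (0 < w → (nCSAPolyCode f α N Φ dec).downloadCost (ncsaThreshold N ℓ K) =
              (ncsaThreshold N ℓ K : ℚ≥0) / (ℓ * K)) ∧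
            (∀ m, ∃ t, ComputableWithOps t ((nCSAPolyCode f α N Φ dec).encFlat m) ∧
              (t : ℝ) / (ℓ * K) ≤
                C * (v m * S * logFactor S ^ 2 / K) * logFactor S ^ c) ∧
            (∀ T : Finset (Fin S), T.card = ncsaThreshold N ℓ K →
              ∃ t, ComputableWithOps t ((nCSAPolyCode f α N Φ dec).decFlat T) ∧
                (t : ℝ) / (ℓ * K) ≤
                  C * ((ℓ + N - 1) / ℓ * w * logFactor (ncsaThreshold N ℓ K) ^ 2) *
                    logFactor (ncsaThreshold N ℓ K) ^ c))) ∧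
        -- no smaller number of servers is enough for all `N`-linear maps
        (∃ (w : ℕ) (v : Fin N → ℕ)
            (Ω : MultilinearMap F (fun n : Fin N => Fin (v n) → F) (Fin w → F)),
          ∀ r < ncsaThreshold N ℓ K, ∀ dec : DecoderFamily F S (ℓ * K) w,
            ¬ (nCSACode f α Ω dec).Recoverable Ω r) ∧
        -- for `ℓ = 1` these are the LCC codes, up to nonzero constants on the data and the answers
        (ℓ = 1 → ∀ β : Fin (ℓ * K) → F, (∀ l k, β (finProdFinEquiv (l, k)) = f l k) →
          ncsaThreshold N ℓ K = K * N - N + 1 ∧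
          (∀ i, lccWeight β i ≠ 0) ∧ (∀ l s, csaDelta f α l s ≠ 0) ∧
          (∀ (d : ℕ) (x : Fin (ℓ * K) → Fin d → F) (s : Fin S) (l : Fin ℓ) (i : Fin d),
            lccShare β α s x i = csaShare f α s (fun a => lccWeight β a • x a) (l, i)) ∧
          (∀ (w : ℕ) (v : Fin N → ℕ)
              (Ω : MultilinearMap F (fun n : Fin N => Fin (v n) → F) (Fin w → F)),
            (∀ (x : ∀ n, Fin (ℓ * K) → Fin (v n) → F) (s : Fin S) (l : Fin ℓ),
              Ω (fun n => lccShare β α s (x n)) = csaDelta f α l s •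
                csaAnswer f α Ω s fun n => csaShare f α s fun a => lccWeight β a • x n a) ∧
            ∃ dec, (lccCode β α Ω dec).Recoverable Ω (K * N - N + 1)) ∧
          (∀ (M w : ℕ) (v : Fin M → ℕ) (Φ : Fin w → MvPolynomial (Σ m : Fin M, Fin (v m)) F),
            (∀ j, (Φ j).totalDegree ≤ N) →
            (∀ (x : ∀ m, Fin (ℓ * K) → Fin (v m) → F) (s : Fin S) (l : Fin ℓ),
              polyMap Φ (fun m => lccShare β α s (x m)) = csaDelta f α l s •
                csaPolyAnswer f α N Φ s (csaShare f α s fun a _ => lccWeight β a)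
                  fun m => csaShare f α s fun a => lccWeight β a • x m a) ∧
            ∃ dec, (lccCode β α (polyMap Φ) dec).Recoverable (polyMap Φ) (K * N - N + 1))) := by
  -- Both constants come from the Cauchy products, where log^6 is written as log^2 * log^4; the
  -- servers only need the factors 2 and 3.
  refine ⟨200000, 4, fun F _ N S ℓ K hN hℓ hK hF hR => ?_⟩
  have hLR := (mul_le_ncsaThreshold hN hℓ hK).trans hR
  have hKS : K ≤ S := (Nat.le_mul_of_pos_left K hℓ).trans hLR
  have hS : 1 ≤ S := hK.trans hKS
  have hSF : ((S + 1 : ℕ) : ℕ∞) ≤ ENat.card F :=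
    le_trans (by exact_mod_cast (by nlinarith : S + 1 ≤ ℓ * K + S)) hF
  refine ⟨exists_distinctPoints hF, fun f α h =>
    ⟨fun w => ⟨csaDecoder f α N w, fun v Ω => ⟨h.nCSACode_recoverable hℓ hK Ω,
      fun n hn => uploadCost_eq hℓ hn, fun hw => downloadCost_eq hR hw, fun ω H s => ?_,
      fun n => ?_, fun T hT => ?_⟩, fun M v Φ hΦ => ⟨h.nCSAPolyCode_recoverable hℓ hK hΦ,
      fun n hn => uploadCost_eq hℓ hn, fun hw => downloadCost_eq hR hw,
      fun n => ?_, fun T hT => ?_⟩⟩, ⟨1, fun _ => 1, productMap F N, fun r hr dec =>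
        h.not_recoverable hℓ hK hN hR hr dec⟩, ?_⟩⟩
  · have hℓ' : (0 : ℝ) < ℓ := by exact_mod_cast hℓ
    have hK' : (0 : ℝ) < K := by exact_mod_cast hK
    refine ⟨⟨_, csaAnswerOps Ω f α s H, ?_⟩, fun hN2 => ⟨_, csaAnswerOps_of_two_le Ω hN2 f α s H, ?_⟩⟩
    · push_cast
      rw [show (ℓ * ω + w * (ℓ * 2) : ℝ) = ℓ * (ω + 2 * w) by ring,
        mul_div_mul_left _ _ hℓ'.ne', ← mul_div_assoc]
      gcongr
      have h1 : (0 : ℝ) ≤ ω := Nat.cast_nonneg ω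
      have h2 : (0 : ℝ) ≤ w := Nat.cast_nonneg w
      linarith
    · push_cast
      rw [show (ℓ * ω + ω * (ℓ * 2) : ℝ) = ℓ * (3 * ω) by ring,
        mul_div_mul_left _ _ hℓ'.ne', ← mul_div_assoc]
      gcongr
      norm_num
  · exact_mod_cast h.exists_csaShareOps hS hℓ hK hKS hSF (v n)
  · exact_mod_cast h.exists_csaDecoderOps hℓ hK hN hR hSF w T hT
  · exact_mod_cast h.exists_csaShareOps hS hℓ hK hKS hSF (v n)
  · exact_mod_cast h.exists_csaDecoderOps hℓ hK hN hR hSF w T hT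
  · rintro rfl β hβ
    have hthr : ncsaThreshold N 1 K = K * N - N + 1 := by simp [ncsaThreshold]
    refine ⟨hthr, h.lccWeight_ne_zero hβ, h.csaDelta_ne_zero, fun d x s l i =>
      h.lccShare_eq hβ x s l i, fun w v Ω => ⟨h.map_lccShare_eq hβ Ω, _,
        hthr ▸ h.lccCode_recoverable hK hβ Ω⟩, fun M w v Φ hΦ =>
      ⟨h.polyMap_lccShare_eq hK hβ N Φ, _, hthr ▸ h.lccCode_polyMap_recoverable hK hβ hΦ⟩⟩
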